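/- Let $\mathcal C$ be an abelian category, $n\ge 1$ an integer and $W:\mathrm{id}_{\mathcal C}\to\mathrm{id}_{\mathcal C}$ a natural transformation. Let $MF^n(\mathcal C,W)$ be the category of $n$-step matrix factorizations: objects are families $M_i\in\mathcal C$ with arrows $d_i:M_i\to M_{i+1}$, $i\in\mathbb Z/n$, such that every composite of $n$ consecutive arrows $M_i\to M_i$ equals $W_{M_i}$; morphisms are the families of morphisms $M_i\to N_i$ commuting with the $d_i$. Consider two exact structures on it: the graded-split one, $MF^n_{ex}$, in which a sequence $0\to M\to N\to L\to 0$ is admissible if every $0\to M_i\to N_i\to L_i\to 0$ is split exact in $\mathcal C$, and the abelian one, $MF^n_{ab}$, in which it is admissible if every $0\to M_i\to N_i\to L_i\to 0$ is short exact in $\mathcal C$. A complex is called acyclic for an exact structure if its differentials factor as $K^j\to Z^{j+1}\to K^{j+1}$ with all $0\to Z^j\to K^j\to Z^{j+1}\to 0$ admissible. For each of the two structures let $D^b$ be the Verdier quotient of the bounded homotopy category $K^b(MF^n(\mathcal C,W))$ by the acyclic complexes. (Verdier quotients by a class of objects are taken by the smallest thick triangulated subcategory containing that class.) Let $q_1:D^b(MF^n_{ex}(\mathcal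 C,W))\to D^b(MF^n_{ab}(\mathcal C,W))$ be the canonical functor, let $\mathcal K\subset D^b(MF^n_{ex}(\mathcal C,W))$ be the class of the complexes that are acyclic for the abelian exact structure, and let $K^b(\mathrm{ProjInj})$ be the class of bounded complexes of projective-injective objects of the graded-split exact structure, considered in $D^b(MF^n_{ex}(\mathcal C,W))$ or in $D^b(MF^n_{ab}(\mathcal C,W))$. Let $\mathrm{Stab}$ be the stable category of $MF^n_{ex}(\mathcal C,W)$, i.e. the quotient of $MF^n(\mathcal C,W)$ by the morphisms that factor through a projective-injective object of the graded-split structure. The functor sending $X$ to $X$ in degree zero is an equivalence $\mathrm{Stab}\simeq D^b(MF^n_{ex}(\mathcal C,W))/K^b(\mathrm{ProjInj})$, through which $\mathrm{Stab}$ is triangulated. Let $\mathrm{Tot}:D^b(MF^n_{ex}(\mathcal C,W))\to\mathrm{Stab}$ be the quotient functor followed by an inverse of this equivalence, let $D^{abs}MF^n(\mathcal C,W):=\mathrm{Stab}/\mathrm{Tot}(\mathcal K)$ be the absolute derived category, and let $q_2:\mathrm{Stab}\to D^{abs}MF^n(\mathcal C,W)$ be the quotient functor. Then $\mathrm{Tot}$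 induces an equivalence of triangulated categories $$D^b(MF^n_{ab}(\mathcal C,W))/K^b(\mathrm{ProjInj})\;\simeq\; D^{abs}MF^n(\mathcal C,W),$$ that is, there is a triangulated equivalence $\Phi$ between these categories such that $\Phi\circ q\circ q_1\cong q_2\circ\mathrm{Tot}$, where $q:D^b(MF^n_{ab}(\mathcal C,W))\to D^b(MF^n_{ab}(\mathcal C,W))/K^b(\mathrm{ProjInj})$ is the quotient functor. -/

import Mathlib

open CategoryTheory Limits Pretriangulated ZeroObject

universe v u

namespace NStep

/-!
Main definitions, in order:

* `MF n W`: matrix factorizations with `n` steps; `exSeq`, `abSeq`: their graded-split and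
  abelian exact structures; `ProjInj S`: the projective-injective objects for a class `S` of short
  exact sequences;
* `AcyclicWith S`: acyclic complexes; `Kb`: the bounded homotopy category; `exAcyclic`, `abAcyclic`;
* `stabRel`, `Stab`: the stable category as an additive category;
* `VerdierQuotient`, `quotientFunctor`: Verdier quotients;
* `Dex`, `Dab`: the two bounded derived categories, and `q₁` between them; `KbProjInjEx`,
  `KbProjInjAb`: bounded complexes of projective-injectives in each of them;
* `stabToQuotient`: the functor from the stable category to the quotient of `Dex` by
  `KbProjInjEx` sending `X` to `X` in degree zero, which is proved to be an equivalence;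
* `StabMF`, `Tot`, `Dabs`, `q₂`: the triangulated stable category, the totalization functor, the
  absolute derived category and the quotient functor to it.

All the other declarations are proved facts that these definitions rest on; most of them serve
the proof that `stabToQuotient` is an equivalence, which the definition of `Tot` needs.
-/

section Basic

variable {C : Type u} [Category.{v} C]

/-- The composite of `k` consecutive arrows of a cyclic sequence of objects and arrows,
from position `i` to position `j = i + k`. -/
def iter {n : ℕ} {X : ZMod n → C} (d : ∀ i, X i ⟶ X (i + 1)) :
    ∀ (k : ℕ) (i j : ZMod n), i + k = j → (X i ⟶ X j)
  | 0, i, j, h => eqToHom (congrArg X (by simpa using h))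
  | k + 1, i, j, h => d i ≫ iter d k (i + 1) j (by rw [← h]; push_cast; ring)

/-- An `n`-step matrix factorization of the natural transformation `W : 𝟭 C ⟶ 𝟭 C`:
objects `X i` and arrows `d i : X i ⟶ X (i + 1)` indexed by `ℤ/n`, such that every
composite of `n` consecutive arrows is the action of `W`. -/
structure MF (n : ℕ) (W : 𝟭 C ⟶ 𝟭 C) where
  /-- the graded components -/
  X : ZMod n → C
  /-- the structure maps -/
  d : ∀ i, X i ⟶ X (i + 1)
  iter_d : ∀ i, iter d n i i (by simp) = W.app (X i)

namespace MF

variable {n : ℕ} {W : 𝟭 C ⟶ 𝟭 C}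

/-- A morphism of matrix factorizations: componentwise, commuting with the structure maps. -/
@[ext]
structure Hom (M N : MF n W) where
  /-- the components -/
  f : ∀ i, M.X i ⟶ N.X i
  comm : ∀ i, f i ≫ N.d i = M.d i ≫ f (i + 1)

instance : Category (MF n W) where
  Hom := Hom
  id M := { f := fun _ => 𝟙 _, comm := by simp }
  comp φ ψ :=
    { f := fun i => φ.f i ≫ ψ.f i
      comm := fun i => by
        rw [Category.assoc, ψ.comm, ← Category.assoc, φ.comm, Category.assoc] }
  id_comp _ := by ext; simp
  comp_id _ := by ext; simp
  assoc _ _ _ := by ext; simp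

@[ext]
lemma hom_ext {M N : MF n W} {f g : M ⟶ N} (h : ∀ i, f.f i = g.f i) : f = g :=
  Hom.ext (funext h)

@[simp] lemma id_f (M : MF n W) (i : ZMod n) : Hom.f (𝟙 M) i = 𝟙 _ := rfl

@[simp] lemma comp_f {M N L : MF n W} (f : M ⟶ N) (g : N ⟶ L) (i : ZMod n) :
    (f ≫ g).f i = f.f i ≫ g.f i := rfl

/-- The functor taking the `i`-th graded component. -/
@[simps]
def ev (n : ℕ) (W : 𝟭 C ⟶ 𝟭 C) (i : ZMod n) : MF n W ⥤ C where
  obj M := M.X i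
  map f := f.f i

end MF

lemma iter_natural {n : ℕ} {X Y : ZMod n → C} (d : ∀ i, X i ⟶ X (i + 1))
    (d' : ∀ i, Y i ⟶ Y (i + 1)) (f : ∀ i, X i ⟶ Y i)
    (comm : ∀ i, f i ≫ d' i = d i ≫ f (i + 1)) (k : ℕ) (i j : ZMod n) (h : i + k = j) :
    f i ≫ iter d' k i j h = iter d k i j h ≫ f j := by
  induction k generalizing i with
  | zero => obtain rfl : i = j := by simpa using h
            simp [iter]
  | succ k ih =>
    simp only [iter, Category.assoc]
    rw [← ih, ← Category.assoc, comm, Category.assoc]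

lemma iter_succ' {n : ℕ} {X : ZMod n → C} (d : ∀ i, X i ⟶ X (i + 1))
    (k : ℕ) (i j : ZMod n) (h : i + k = j) (h' : i + (k + 1 : ℕ) = j + 1) :
    iter d (k + 1) i (j + 1) h' = iter d k i j h ≫ d j := by
  induction k generalizing i with
  | zero => obtain rfl : i = j := by simpa using h
            simp [iter]
  | succ k ih =>
    rw [iter, ih (i + 1) (by rw [← h]; push_cast; ring)]
    simp only [iter, Category.assoc]

end Basic

section Additive

variable {C : Type u} [Category.{v} C] [Preadditive C] {n : ℕ} {W : 𝟭 C ⟶ 𝟭 C}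

namespace MF

instance (M N : MF n W) : Zero (M ⟶ N) := ⟨{ f := fun _ => 0, comm := by simp }⟩
instance (M N : MF n W) : Add (M ⟶ N) :=
  ⟨fun φ ψ => { f := fun i => φ.f i + ψ.f i, comm := fun i => by simp [φ.comm, ψ.comm] }⟩
instance (M N : MF n W) : Neg (M ⟶ N) :=
  ⟨fun φ => { f := fun i => - φ.f i, comm := fun i => by simp [φ.comm] }⟩
instance (M N : MF n W) : Sub (M ⟶ N) :=
  ⟨fun φ ψ => { f := fun i => φ.f i - ψ.f i, comm := fun i => by simp [φ.comm, ψ.comm] }⟩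

@[simp] lemma zero_f (M N : MF n W) (i : ZMod n) : Hom.f (0 : M ⟶ N) i = 0 := rfl
@[simp] lemma add_f {M N : MF n W} (f g : M ⟶ N) (i : ZMod n) :
    Hom.f (f + g) i = f.f i + g.f i := rfl
@[simp] lemma neg_f {M N : MF n W} (f : M ⟶ N) (i : ZMod n) : Hom.f (-f) i = - f.f i := rfl
@[simp] lemma sub_f {M N : MF n W} (f g : M ⟶ N) (i : ZMod n) :
    Hom.f (f - g) i = f.f i - g.f i := rfl

instance (M N : MF n W) : AddCommGroup (M ⟶ N) where
  add_assoc _ _ _ := by ext; simp [add_assoc]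
  zero_add _ := by ext; simp
  add_zero _ := by ext; simp
  add_comm _ _ := by ext; simp [add_comm]
  neg_add_cancel _ := by ext; simp
  sub_eq_add_neg _ _ := by ext; simp [sub_eq_add_neg]
  nsmul := nsmulRec
  zsmul := zsmulRec

instance : Preadditive (MF n W) where
  add_comp _ _ _ _ _ _ := by ext; simp
  comp_add _ _ _ _ _ _ := by ext; simp

instance (i : ZMod n) : (ev n W i).Additive where

/-- A matrix factorization all of whose components are zero objects is a zero object. -/
lemma isZero_of_isZero_X (M : MF n W) (h : ∀ i, IsZero (M.X i)) : IsZero M := by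
  rw [IsZero.iff_id_eq_zero]
  ext i
  exact (h i).eq_of_src _ _

instance [HasZeroObject C] : HasZeroObject (MF n W) :=
  ⟨{ X := fun _ => (HasZeroObject.zero (C := C)).choose, d := fun _ => 𝟙 _, iter_d := fun _ => (HasZeroObject.zero (C := C)).choose_spec.eq_of_src _ _ },
    isZero_of_isZero_X _ fun _ => (HasZeroObject.zero (C := C)).choose_spec⟩

/-- The componentwise binary biproduct of matrix factorizations. -/
@[simps]
noncomputable def biprodObj [HasBinaryBiproducts C] (M N : MF n W) : MF n W where
  X i := M.X i ⊞ N.X i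
  d i := biprod.map (M.d i) (N.d i)
  iter_d i := by
    apply biprod.hom_ext
    · rw [← iter_natural (fun i => biprod.map (M.d i) (N.d i)) M.d (fun _ => biprod.fst)
        (by simp), M.iter_d]
      exact W.naturality _
    · rw [← iter_natural (fun i => biprod.map (M.d i) (N.d i)) N.d (fun _ => biprod.snd)
        (by simp), N.iter_d]
      exact W.naturality _

/-- The componentwise bicone. -/
@[simps]
noncomputable def biprodBicone [HasBinaryBiproducts C] (M N : MF n W) : BinaryBicone M N where
  pt := biprodObj M N
  fst := { f := fun _ => biprod.fst, comm := fun _ => (biprod.map_fst _ _).symm }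
  snd := { f := fun _ => biprod.snd, comm := fun _ => (biprod.map_snd _ _).symm }
  inl := { f := fun _ => biprod.inl, comm := fun _ => biprod.inl_map _ _ }
  inr := { f := fun _ => biprod.inr, comm := fun _ => biprod.inr_map _ _ }
  inl_fst := by ext; exact biprod.inl_fst
  inl_snd := by ext; exact biprod.inl_snd
  inr_fst := by ext; exact biprod.inr_fst
  inr_snd := by ext; exact biprod.inr_snd

instance [HasBinaryBiproducts C] : HasBinaryBiproducts (MF n W) where
  has_binary_biproduct M N := hasBinaryBiproduct_of_total (biprodBicone M N) (by
    ext i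
    exact biprod.total)

end MF

end Additive

section ExactStructure

variable {E : Type u} [Category.{v} E] [HasZeroMorphisms E]

/-- The objects that are projective with respect to a class `S` of short exact sequences. -/
def IsProj (S : ObjectProperty (ShortComplex E)) : ObjectProperty E :=
  fun P => ∀ T : ShortComplex E, S T → ∀ f : P ⟶ T.X₃, ∃ g : P ⟶ T.X₂, g ≫ T.g = f

/-- The objects that are injective with respect to a class `S` of short exact sequences. -/
def IsInj (S : ObjectProperty (ShortComplex E)) : ObjectProperty E :=
  fun I => ∀ T : ShortComplex E, S T → ∀ f : T.X₁ ⟶ I, ∃ g : T.X₂ ⟶ I, T.f ≫ g = f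

/-- The projective-injective objects with respect to a class `S` of short exact sequences. -/
def ProjInj (S : ObjectProperty (ShortComplex E)) : ObjectProperty E :=
  fun P => IsProj S P ∧ IsInj S P

end ExactStructure

section Abelian

variable {C : Type u} [Category.{v} C] [Abelian C] (n : ℕ) (W : 𝟭 C ⟶ 𝟭 C)

/-- The graded-split exact structure on `n`-step matrix factorizations: the sequences
`0 ⟶ M ⟶ N ⟶ L ⟶ 0` such that every `0 ⟶ M i ⟶ N i ⟶ L i ⟶ 0` splits. -/
def exSeq : ObjectProperty (ShortComplex (MF n W)) :=
  fun S => ∀ i, Nonempty (S.map (MF.ev n W i)).Splitting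

/-- The abelian exact structure on `n`-step matrix factorizations: the sequences
`0 ⟶ M ⟶ N ⟶ L ⟶ 0` such that every `0 ⟶ M i ⟶ N i ⟶ L i ⟶ 0` is short exact. -/
def abSeq : ObjectProperty (ShortComplex (MF n W)) :=
  fun S => ∀ i, (S.map (MF.ev n W i)).ShortExact

end Abelian

section Iterates

variable {C : Type u} [Category.{v} C] {n : ℕ} {W : 𝟭 C ⟶ 𝟭 C}

lemma iter_of_eq_zero {X : ZMod n → C} (d : ∀ i, X i ⟶ X (i + 1)) (k : ℕ) (hk : k = 0)
    (i : ZMod n) (h : i + k = i) : iter d k i i h = 𝟙 _ := by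
  subst hk; simp [iter]

lemma iter_eq_W (M : MF n W) (k : ℕ) (hk : k = n) (i : ZMod n) (h : i + k = i) :
    iter M.d k i i h = W.app (M.X i) := by
  subst hk; exact M.iter_d i

lemma iter_congr {X : ZMod n → C} (d : ∀ i, X i ⟶ X (i + 1)) (k l : ℕ) (hk : k = l)
    (i j : ZMod n) (h : i + k = j) : iter d k i j h = iter d l i j (hk ▸ h) := by
  subst hk; rfl

end Iterates

section Trivial

variable {C : Type u} [Category.{v} C] {n : ℕ} [NeZero n] {W : 𝟭 C ⟶ 𝟭 C}

lemma ZMod_val_sub_one (x : ZMod n) (hx : x ≠ 0) : (x - 1).val + 1 = x.val := by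
  have h0 : x.val ≠ 0 := by simpa using hx
  have hlt := x.val_lt
  have : x - 1 = ((x.val - 1 : ℕ) : ZMod n) := by
    rw [Nat.cast_sub (by omega)]; simp
  rw [this, ZMod.val_natCast, Nat.mod_eq_of_lt (by omega)]
  omega

lemma ZMod_val_neg_one : (-1 : ZMod n).val + 1 = n := by
  obtain ⟨m, rfl⟩ := Nat.exists_eq_succ_of_ne_zero (NeZero.ne n)
  rw [ZMod.val_neg_one]

/-- The arrows of the trivial factorization on `X` with `W` arriving at position `a`. -/
def trivD (W : 𝟭 C ⟶ 𝟭 C) (a : ZMod n) (X : C) (j : ZMod n) : X ⟶ X :=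
  if j + 1 = a then W.app X else 𝟙 X

lemma iter_trivD (a : ZMod n) (X : C) (k : ℕ) (i j : ZMod n) (h : i + k = j) (hk : k ≤ n) :
    iter (X := fun _ => X) (trivD W a X) k i j h =
      if (a - i - 1).val < k then W.app X else 𝟙 X := by
  induction k generalizing i with
  | zero => simp [iter]
  | succ k ih =>
    rw [iter, ih _ _ (by omega)]
    by_cases hi : i + 1 = a
    · subst hi
      have h1 : (i + 1 - (i + 1) - 1 : ZMod n) = -1 := by ring
      have h2 : (i + 1 - i - 1 : ZMod n) = 0 := by ring
      have := ZMod_val_neg_one (n := n)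
      rw [h1, h2, if_neg (by omega), if_pos (by simp), trivD, if_pos rfl, Category.comp_id]
    · have hne : a - i - 1 ≠ 0 := fun h => hi (by linear_combination -h)
      have := ZMod_val_sub_one _ hne
      have e : a - (i + 1) - 1 = a - i - 1 - 1 := by ring
      rw [e, trivD, if_neg hi, Category.id_comp]
      congr 1
      simp only [eq_iff_iff]
      omega

/-- The trivial matrix factorization on `X`, all of whose arrows are identities except the
one arriving at position `a`, which is `W`. -/
@[simps]
def triv (W : 𝟭 C ⟶ 𝟭 C) (a : ZMod n) (X : C) : MF n W where
  X _ := X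
  d j := trivD W a X j
  iter_d i := by
    rw [iter_trivD _ _ _ _ _ _ le_rfl, if_pos (ZMod.val_lt _)]

lemma trivDesc_comm (M : MF n W) (a : ZMod n) {X : C} (x : X ⟶ M.X a) (j : ZMod n) :
    (x ≫ iter M.d (j - a).val a j (by simp)) ≫ M.d j =
      trivD W a X j ≫ x ≫ iter M.d (j + 1 - a).val a (j + 1) (by simp) := by
  by_cases hj : j + 1 = a
  · subst hj
    have h1 : (j - (j + 1)).val + 1 = n := by
      rw [show j - (j + 1) = -1 by ring]; exact ZMod_val_neg_one
    rw [Category.assoc, ← iter_succ' M.d _ _ _ _ (by rw [h1]; simp), iter_eq_W M _ h1,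
      iter_of_eq_zero M.d _ (by simp), Category.comp_id, trivD, if_pos rfl]
    exact W.naturality x
  · have hne : j + 1 - a ≠ 0 := fun h => hj (by linear_combination h)
    have h1 := ZMod_val_sub_one _ hne
    rw [show j + 1 - a - 1 = j - a by ring] at h1
    rw [Category.assoc, ← iter_succ' M.d _ _ _ _ (by rw [h1]; simp), iter_congr M.d _ _ h1,
      trivD, if_neg hj, Category.id_comp]

lemma trivLift_comm (M : MF n W) (b : ZMod n) {X : C} (y : M.X b ⟶ X) (j : ZMod n) :
    (iter M.d (b - j).val j b (by simp) ≫ y) ≫ trivD W (b + 1) X j =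
      M.d j ≫ iter M.d (b - (j + 1)).val (j + 1) b (by simp) ≫ y := by
  by_cases hj : j = b
  · subst hj
    have h1 : (j - (j + 1)).val + 1 = n := by
      rw [show j - (j + 1) = -1 by ring]; exact ZMod_val_neg_one
    have h2 : j + (((j - (j + 1)).val + 1 : ℕ) : ZMod n) = j := by rw [h1]; simp
    have h3 : M.d j ≫ iter M.d (j - (j + 1)).val (j + 1) j (by simp) = W.app (M.X j) := by
      rw [← iter_eq_W M _ h1 j h2, iter]
    rw [← Category.assoc (M.d j), h3, iter_of_eq_zero M.d _ (by simp), Category.id_comp,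
      trivD, if_pos rfl]
    exact W.naturality y
  · have hne : b - j ≠ 0 := fun h => hj (by linear_combination -h)
    have h1 := ZMod_val_sub_one _ hne
    rw [show b - j - 1 = b - (j + 1) by ring] at h1
    have h2 : j + (((b - (j + 1)).val + 1 : ℕ) : ZMod n) = b := by rw [h1]; simp
    have h3 : M.d j ≫ iter M.d (b - (j + 1)).val (j + 1) b (by simp) =
        iter M.d (b - j).val j b (by simp) := by
      rw [iter_congr M.d _ _ h1.symm, iter]
    rw [← Category.assoc (M.d j), h3, trivD, if_neg (fun h => hj (by linear_combination h)),
      Category.comp_id]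

/-- The morphism out of a trivial factorization given by a morphism to the component `a`. -/
def trivDesc (M : MF n W) (a : ZMod n) {X : C} (x : X ⟶ M.X a) : triv W a X ⟶ M where
  f j := x ≫ iter M.d (j - a).val a j (by simp)
  comm := trivDesc_comm M a x

/-- The morphism to a trivial factorization given by a morphism from the component `b`. -/
def trivLift (M : MF n W) (b : ZMod n) {X : C} (y : M.X b ⟶ X) : M ⟶ triv W (b + 1) X where
  f j := iter M.d (b - j).val j b (by simp) ≫ y
  comm := trivLift_comm M b y

lemma trivDesc_f_self (M : MF n W) (a : ZMod n) {X : C} (x : X ⟶ M.X a) :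
    (trivDesc M a x).f a = x := by
  change x ≫ iter M.d _ _ _ _ = x
  rw [iter_of_eq_zero M.d _ (by simp), Category.comp_id]

lemma trivLift_f_self (M : MF n W) (b : ZMod n) {X : C} (y : M.X b ⟶ X) :
    (trivLift M b y).f b = y := by
  change iter M.d _ _ _ _ ≫ y = y
  rw [iter_of_eq_zero M.d _ (by simp), Category.id_comp]

lemma triv_hom_ext {M : MF n W} {a : ZMod n} {X : C} {f g : triv W a X ⟶ M}
    (h : f.f a = g.f a) : f = g := by
  ext j
  have key : ∀ φ : triv W a X ⟶ M, φ.f j = φ.f a ≫ iter M.d (j - a).val a j (by simp) := by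
    intro φ
    have := iter_natural _ _ φ.f φ.comm (j - a).val a j (by simp)
    rw [this]
    have e := iter_trivD (W := W) a X (j - a).val a j (by simp) (ZMod.val_lt _).le
    have h1 := ZMod_val_neg_one (n := n)
    have h2 := (j - a).val_lt
    rw [show a - a - 1 = -1 by ring, if_neg (by omega)] at e
    dsimp only [triv] at e ⊢
    erw [e, Category.id_comp]
  rw [key f, key g, h]

lemma hom_triv_ext {M : MF n W} {b : ZMod n} {X : C} {f g : M ⟶ triv W (b + 1) X}
    (h : f.f b = g.f b) : f = g := by
  ext j
  have key : ∀ φ : M ⟶ triv W (b + 1) X,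
      φ.f j = iter M.d (b - j).val j b (by simp) ≫ φ.f b := by
    intro φ
    have := iter_natural _ _ φ.f φ.comm (b - j).val j b (by simp)
    rw [← this]
    have e := iter_trivD (W := W) (b + 1) X (b - j).val j b (by simp) (ZMod.val_lt _).le
    rw [show b + 1 - j - 1 = b - j by ring, if_neg (by omega)] at e
    dsimp only [triv] at e ⊢
    erw [e, Category.comp_id]
  rw [key f, key g, h]

end Trivial

section Kernels

variable {C : Type u} [Category.{v} C] [Abelian C] {n : ℕ} {W : 𝟭 C ⟶ 𝟭 C}

/-- The componentwise kernel. -/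
noncomputable def kerObj {M N : MF n W} (g : M ⟶ N) : MF n W where
  X i := kernel (g.f i)
  d i := kernel.map _ _ (M.d i) (N.d i) (g.comm i)
  iter_d i := by
    rw [← cancel_mono (kernel.ι (g.f i)),
      ← iter_natural (fun i => kernel.map _ _ (M.d i) (N.d i) (g.comm i)) M.d
        (fun i => kernel.ι (g.f i)) (by simp), M.iter_d]
    exact W.naturality _

/-- The inclusion of the componentwise kernel. -/
noncomputable def kerι {M N : MF n W} (g : M ⟶ N) : kerObj g ⟶ M where
  f i := kernel.ι (g.f i)
  comm _ := (kernel.lift_ι _ _ _).symm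

/-- The componentwise cokernel. -/
noncomputable def cokerObj {M N : MF n W} (g : M ⟶ N) : MF n W where
  X i := cokernel (g.f i)
  d i := cokernel.map _ _ (M.d i) (N.d i) (g.comm i)
  iter_d i := by
    rw [← cancel_epi (cokernel.π (g.f i)),
      iter_natural N.d (fun i => cokernel.map _ _ (M.d i) (N.d i) (g.comm i))
        (fun i => cokernel.π (g.f i)) (by simp), N.iter_d]
    exact (W.naturality _).symm

/-- The projection to the componentwise cokernel. -/
noncomputable def cokerπ {M N : MF n W} (g : M ⟶ N) : N ⟶ cokerObj g where
  f i := cokernel.π (g.f i)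
  comm _ := cokernel.π_desc _ _ _

/-- The short complex given by the kernel of a morphism. -/
@[simps]
noncomputable def kerSeq {M N : MF n W} (g : M ⟶ N) : ShortComplex (MF n W) where
  f := kerι g
  g := g
  zero := by ext i; exact kernel.condition _

/-- The short complex given by the cokernel of a morphism. -/
@[simps]
noncomputable def cokerSeq {M N : MF n W} (g : M ⟶ N) : ShortComplex (MF n W) where
  f := g
  g := cokerπ g
  zero := by ext i; exact cokernel.condition _

lemma exSeq_kerSeq {M N : MF n W} (g : M ⟶ N) (h : ∀ i, ∃ s, s ≫ g.f i = 𝟙 (N.X i)) :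
    exSeq n W (kerSeq g) := by
  intro i
  obtain ⟨s, hs⟩ := h i
  have : Mono ((kerSeq g).map (MF.ev n W i)).f := inferInstanceAs (Mono (kernel.ι (g.f i)))
  exact ⟨ShortComplex.Splitting.ofExactOfSection _
    (ShortComplex.exact_of_f_is_kernel _ (kernelIsKernel (g.f i))) s hs this⟩

lemma exSeq_cokerSeq {M N : MF n W} (g : M ⟶ N) (h : ∀ i, ∃ r, g.f i ≫ r = 𝟙 (M.X i)) :
    exSeq n W (cokerSeq g) := by
  intro i
  obtain ⟨r, hr⟩ := h i
  have : Epi ((cokerSeq g).map (MF.ev n W i)).g := inferInstanceAs (Epi (cokernel.π (g.f i)))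
  exact ⟨ShortComplex.Splitting.ofExactOfRetraction _
    (ShortComplex.exact_of_g_is_cokernel _ (cokernelIsCokernel (g.f i))) r hr this⟩

lemma exSeq.data {S : ShortComplex (MF n W)} (hS : exSeq n W S) (i : ZMod n) :
    ∃ (r : S.X₂.X i ⟶ S.X₁.X i) (s : S.X₃.X i ⟶ S.X₂.X i), S.f.f i ≫ r = 𝟙 _ ∧
      s ≫ S.g.f i = 𝟙 _ ∧ r ≫ S.f.f i + S.g.f i ≫ s = 𝟙 _ :=
  ⟨(hS i).some.r, (hS i).some.s, (hS i).some.f_r, (hS i).some.s_g, (hS i).some.id⟩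

lemma exSeq.exists_lift {S : ShortComplex (MF n W)} (hS : exSeq n W S) {T : MF n W}
    (f : T ⟶ S.X₂) (hf : f ≫ S.g = 0) : ∃ g, g ≫ S.f = f := by
  choose r s h1 h2 h3 using hS.data
  have hm : ∀ i, Mono (S.f.f i) := fun i => (hS i).some.mono_f
  have hk : ∀ i, (f.f i ≫ r i) ≫ S.f.f i = f.f i := by
    intro i
    have h4 : f.f i ≫ S.g.f i = 0 := congrArg (fun φ => MF.Hom.f φ i) hf
    have h5 := congrArg (fun φ => f.f i ≫ φ) (h3 i)
    simpa [reassoc_of% h4] using h5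
  refine ⟨{ f := fun i => f.f i ≫ r i, comm := fun i => ?_ }, ?_⟩
  · rw [← cancel_mono (S.f.f (i + 1)), Category.assoc, ← S.f.comm i, ← Category.assoc, hk,
      f.comm, Category.assoc, hk]
  · ext i
    exact hk i

lemma exSeq.exists_desc {S : ShortComplex (MF n W)} (hS : exSeq n W S) {T : MF n W}
    (f : S.X₂ ⟶ T) (hf : S.f ≫ f = 0) : ∃ g, S.g ≫ g = f := by
  choose r s h1 h2 h3 using hS.data
  have hm : ∀ i, Epi (S.g.f i) := fun i => (hS i).some.epi_g
  have hk : ∀ i, S.g.f i ≫ s i ≫ f.f i = f.f i := by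
    intro i
    have h4 : S.f.f i ≫ f.f i = 0 := congrArg (fun φ => MF.Hom.f φ i) hf
    have h5 := congrArg (fun φ => φ ≫ f.f i) (h3 i)
    simpa [h4] using h5
  refine ⟨{ f := fun i => s i ≫ f.f i, comm := fun i => ?_ }, ?_⟩
  · rw [← cancel_epi (S.g.f i), Category.assoc, reassoc_of% (hk i), f.comm,
      reassoc_of% (S.g.comm i), hk]
  · ext i
    exact hk i

lemma exSeq.epi {S : ShortComplex (MF n W)} (hS : exSeq n W S) {T : MF n W}
    {f g : S.X₃ ⟶ T} (h : S.g ≫ f = S.g ≫ g) : f = g := by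
  ext i
  have : Epi (S.g.f i) := (hS i).some.epi_g
  rw [← cancel_epi (S.g.f i)]
  exact congrArg (fun φ => MF.Hom.f φ i) h

lemma exSeq.mono {S : ShortComplex (MF n W)} (hS : exSeq n W S) {T : MF n W}
    {f g : T ⟶ S.X₁} (h : f ≫ S.f = g ≫ S.f) : f = g := by
  ext i
  have : Mono (S.f.f i) := (hS i).some.mono_f
  rw [← cancel_mono (S.f.f i)]
  exact congrArg (fun φ => MF.Hom.f φ i) h

instance : HasFiniteBiproducts (MF n W) :=
  have : HasFiniteProducts (MF n W) := hasFiniteProducts_of_has_binary_and_terminal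
  HasFiniteBiproducts.of_hasFiniteProducts

end Kernels

section Enough

variable {C : Type u} [Category.{v} C] [Abelian C] {n : ℕ} [NeZero n] {W : 𝟭 C ⟶ 𝟭 C}

/-- The projective-injective objects of the graded-split exact structure. -/
abbrev PI (n : ℕ) (W : 𝟭 C ⟶ 𝟭 C) : ObjectProperty (MF n W) := ProjInj (exSeq n W)

lemma PI_triv (a : ZMod n) (X : C) : PI n W (triv W a X) := by
  constructor
  · intro S hS f
    obtain ⟨r, s, h1, h2, h3⟩ := hS.data a
    let fa : X ⟶ S.X₃.X a := f.f a
    refine ⟨trivDesc _ a (fa ≫ s), triv_hom_ext ?_⟩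
    refine (congrArg (fun φ => φ ≫ S.g.f a) (trivDesc_f_self _ a (fa ≫ s))).trans ?_
    exact (by rw [Category.assoc, h2, Category.comp_id] : (fa ≫ s) ≫ S.g.f a = fa)
  · obtain ⟨b, rfl⟩ : ∃ b, a = b + 1 := ⟨a - 1, by ring⟩
    intro S hS f
    obtain ⟨r, s, h1, h2, h3⟩ := hS.data b
    let fb : S.X₁.X b ⟶ X := f.f b
    refine ⟨trivLift _ b (r ≫ fb), hom_triv_ext ?_⟩
    refine (congrArg (fun φ => S.f.f b ≫ φ) (trivLift_f_self _ b (r ≫ fb))).trans ?_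
    exact (by rw [← Category.assoc, h1, Category.id_comp] : S.f.f b ≫ r ≫ fb = fb)

lemma PI_biproduct (P : ZMod n → MF n W) (hP : ∀ a, PI n W (P a)) : PI n W (⨁ P) := by
  constructor
  · intro S hS f
    choose g hg using fun a => (hP a).1 S hS (biproduct.ι P a ≫ f)
    exact ⟨biproduct.desc g, biproduct.hom_ext' _ _ fun a => by simp [hg]⟩
  · intro S hS f
    choose g hg using fun a => (hP a).2 S hS (f ≫ biproduct.π P a)
    exact ⟨biproduct.lift g, biproduct.hom_ext _ _ fun a => by simp [hg]⟩

lemma exists_proj (M : MF n W) : ∃ S, exSeq n W S ∧ PI n W S.X₂ ∧ S.X₃ = M := by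
  let P : ZMod n → MF n W := fun a => triv W a (M.X a)
  let p : ⨁ P ⟶ M := biproduct.desc fun a => trivDesc M a (𝟙 _)
  refine ⟨kerSeq p, exSeq_kerSeq p fun i => ⟨(biproduct.ι P i).f i, ?_⟩,
    PI_biproduct P fun a => PI_triv _ _, rfl⟩
  have h : biproduct.ι P i ≫ p = trivDesc M i (𝟙 _) := by simp [p]
  have h2 := congrArg (fun φ => MF.Hom.f φ i) h
  exact h2.trans (trivDesc_f_self _ _ _)

lemma exists_inj (M : MF n W) : ∃ S, exSeq n W S ∧ PI n W S.X₂ ∧ S.X₁ = M := by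
  let P : ZMod n → MF n W := fun a => triv W (a + 1) (M.X a)
  let p : M ⟶ ⨁ P := biproduct.lift fun a => trivLift M a (𝟙 _)
  refine ⟨cokerSeq p, exSeq_cokerSeq p fun i => ⟨(biproduct.π P i).f i, ?_⟩,
    PI_biproduct P fun a => PI_triv _ _, rfl⟩
  have h : p ≫ biproduct.π P i = trivLift M i (𝟙 _) := by simp [p]
  have h2 := congrArg (fun φ => MF.Hom.f φ i) h
  exact h2.trans (trivLift_f_self _ _ _)

end Enough

section Acyclic

/-- A complex `K` is acyclic with respect to a class `S` of short exact sequences if its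
differentials factor as `K j ⟶ Z (j + 1) ⟶ K (j + 1)` so that all the sequences
`0 ⟶ Z j ⟶ K j ⟶ Z (j + 1) ⟶ 0` belong to `S`. -/
def AcyclicWith {E : Type u} [Category.{v} E] [HasZeroMorphisms E]
    (S : ObjectProperty (ShortComplex E)) (K : CochainComplex E ℤ) : Prop :=
  ∃ (Z : ℤ → E) (ι : ∀ j, Z j ⟶ K.X j) (π : ∀ j, K.X j ⟶ Z (j + 1)) (w : ∀ j, ι j ≫ π j = 0),
    (∀ j, π j ≫ ι (j + 1) = K.d j (j + 1)) ∧ ∀ j, S (ShortComplex.mk (ι j) (π j) (w j))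

variable {C : Type u} [Category.{v} C] [Abelian C] {n : ℕ} {W : 𝟭 C ⟶ 𝟭 C}

/-- The complex of `i`-th components of a complex of matrix factorizations. -/
abbrev comp (K : CochainComplex (MF n W) ℤ) (i : ZMod n) : CochainComplex C ℤ :=
  ((MF.ev n W i).mapHomologicalComplex (.up ℤ)).obj K

lemma comp_d (K : CochainComplex (MF n W) ℤ) (i : ZMod n) (a b : ℤ) :
    (comp K i).d a b = (K.d a b).f i := rfl

lemma lift_kernel_map {A B A' B' L L' : C} {f : A ⟶ B} {f' : A' ⟶ B'} (a : A ⟶ A') (b : B ⟶ B')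
    (h : f ≫ b = a ≫ f') (x : L ⟶ A) (x' : L' ⟶ A') (y : L ⟶ L') (hxy : x ≫ a = y ≫ x')
    (hx : x ≫ f = 0) (hx' : x' ≫ f' = 0) :
    kernel.lift f x hx ≫ kernel.map f f' a b h = y ≫ kernel.lift f' x' hx' := by
  rw [← cancel_mono (kernel.ι f')]
  simpa using hxy

lemma kernel_comp_lift {A B D : C} (f : A ⟶ B) (g : B ⟶ D) (l : A ⟶ kernel g)
    (hl : l ≫ kernel.ι g = f) : kernel.ι f ≫ l = 0 := by
  rw [← cancel_mono (kernel.ι g), Category.assoc, hl, kernel.condition, zero_comp]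

lemma kernel_lift_exact {A B D : C} (f : A ⟶ B) (g : B ⟶ D) (l : A ⟶ kernel g)
    (hl : l ≫ kernel.ι g = f) :
    (ShortComplex.mk (kernel.ι f) l (kernel_comp_lift f g l hl)).Exact := by
  apply ShortComplex.exact_of_f_is_kernel
  exact KernelFork.IsLimit.ofι _ _
    (fun {A} x hx => kernel.lift f x (by
      rw [← hl, ← Category.assoc]
      exact (congrArg (· ≫ kernel.ι _) hx).trans zero_comp))
    (fun {A} x hx => kernel.lift_ι _ _ _)
    (fun {A} x hx m hm => by
      rw [← cancel_mono (kernel.ι f)]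
      exact hm.trans (kernel.lift_ι _ _ _).symm)

lemma kernel_lift_epi {A B D : C} (f : A ⟶ B) (g : B ⟶ D) (w : f ≫ g = 0) (l : A ⟶ kernel g)
    (hl : l ≫ kernel.ι g = f) (h : (ShortComplex.mk f g w).Exact) : Epi l := by
  have : Epi (kernel.lift g f w) := h.epi_kernelLift
  have e : l = kernel.lift g f w := by
    rw [← cancel_mono (kernel.ι g), kernel.lift_ι, hl]
  rwa [e]

lemma kernel_lift_section {A B D : C} (f : A ⟶ B) (g : B ⟶ D) (l : A ⟶ kernel g)
    (hl : l ≫ kernel.ι g = f) (s1 : B ⟶ A) (s2 : D ⟶ B) (h : 𝟙 B = g ≫ s2 + s1 ≫ f + 0) :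
    (kernel.ι g ≫ s1) ≫ l = 𝟙 _ := by
  rw [← cancel_mono (kernel.ι g), Category.assoc, Category.assoc, hl, Category.id_comp]
  have := congrArg (fun φ => kernel.ι g ≫ φ) h
  simpa using this.symm

lemma exact_glue {A Z₁ B D Z₂ : C} (π₀ : A ⟶ Z₁) (ι₁ : Z₁ ⟶ B) (π₁ : B ⟶ Z₂) (ι₂ : Z₂ ⟶ D)
    (w : ι₁ ≫ π₁ = 0) (h : (ShortComplex.mk ι₁ π₁ w).Exact) [Epi π₀] [Mono ι₂]
    (f : A ⟶ B) (g : B ⟶ D) (hf : π₀ ≫ ι₁ = f) (hg : π₁ ≫ ι₂ = g) (w' : f ≫ g = 0) :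
    (ShortComplex.mk f g w').Exact := by
  subst hf hg
  let φ : ShortComplex.mk (π₀ ≫ ι₁) (π₁ ≫ ι₂) w' ⟶
      ShortComplex.mk ι₁ (π₁ ≫ ι₂) (by rw [reassoc_of% w, zero_comp]) :=
    { τ₁ := π₀, τ₂ := 𝟙 _, τ₃ := 𝟙 _ }
  have e1 : Epi φ.τ₁ := ‹Epi π₀›
  have e2 : IsIso φ.τ₂ := inferInstanceAs (IsIso (𝟙 _))
  have e3 : Mono φ.τ₃ := inferInstanceAs (Mono (𝟙 _))
  rw [ShortComplex.exact_iff_of_epi_of_isIso_of_mono φ]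
  let ψ : ShortComplex.mk ι₁ π₁ w ⟶
      ShortComplex.mk ι₁ (π₁ ≫ ι₂) (by rw [reassoc_of% w, zero_comp]) :=
    { τ₁ := 𝟙 _, τ₂ := 𝟙 _, τ₃ := ι₂ }
  have e1 : Epi ψ.τ₁ := inferInstanceAs (Epi (𝟙 _))
  have e2 : IsIso ψ.τ₂ := inferInstanceAs (IsIso (𝟙 _))
  have e3 : Mono ψ.τ₃ := ‹Mono ι₂›
  exact (ShortComplex.exact_iff_of_epi_of_isIso_of_mono ψ).1 h

lemma kerObj_lift {M N L : MF n W} (g : M ⟶ N) (f : L ⟶ M) (h : f ≫ g = 0) :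
    ∃ l : L ⟶ kerObj g, l ≫ kerι g = f :=
  ⟨{ f := fun i => kernel.lift (g.f i) (f.f i) (congrArg (fun φ => MF.Hom.f φ i) h)
     comm := fun i => lift_kernel_map (M.d i) (N.d i) (g.comm i) _ _ _ (f.comm i) _ _ },
    by ext i; exact kernel.lift_ι _ _ _⟩

lemma mono_kerι {M N : MF n W} (g : M ⟶ N) (i : ZMod n) : Mono ((kerι g).f i) :=
  inferInstanceAs (Mono (kernel.ι (g.f i)))

lemma acyclicWith_of_components (S : ObjectProperty (ShortComplex (MF n W)))
    (K : CochainComplex (MF n W) ℤ)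
    (h : ∀ (j : ℤ) (l : K.X j ⟶ kerObj (K.d (j + 1) (j + 1 + 1)))
      (_ : l ≫ kerι _ = K.d j (j + 1)) (w : kerι (K.d j (j + 1)) ≫ l = 0),
      S (ShortComplex.mk (kerι (K.d j (j + 1))) l w)) :
    AcyclicWith S K := by
  choose l hl using fun j => kerObj_lift (K.d (j + 1) (j + 1 + 1)) (K.d j (j + 1)) (by simp)
  have w : ∀ j, kerι (K.d j (j + 1)) ≫ l j = 0 := fun j => by
    ext i
    exact kernel_comp_lift _ _ _ (congrArg (fun φ => MF.Hom.f φ i) (hl j))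
  exact ⟨fun j => kerObj (K.d j (j + 1)), fun j => kerι _, l, w, hl, fun j => h j (l j) (hl j) (w j)⟩

/-- The contracting homotopy built from splittings. -/
lemma exists_homotopy_of_splitting (K : CochainComplex C ℤ) (Z : ℤ → C)
    (ι : ∀ j, Z j ⟶ K.X j) (π : ∀ j, K.X j ⟶ Z (j + 1))
    (r : ∀ j, K.X j ⟶ Z j) (s : ∀ j, Z (j + 1) ⟶ K.X j)
    (hd : ∀ j, π j ≫ ι (j + 1) = K.d j (j + 1))
    (h1 : ∀ j, ι j ≫ r j = 𝟙 _) (h2 : ∀ j, s j ≫ π j = 𝟙 _)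
    (h3 : ∀ j, r j ≫ ι j + π j ≫ s j = 𝟙 _) : Nonempty (Homotopy (𝟙 K) 0) := by
  have hs : ∀ a b : ℤ, b + 1 = a → ∃ h : K.X a ⟶ K.X b,
      ∀ e : b + 1 = a, h = eqToHom (by rw [e]) ≫ r (b + 1) ≫ s b := by
    rintro a b rfl; exact ⟨r (b + 1) ≫ s b, fun _ => by simp⟩
  classical
  let hh : ∀ a b : ℤ, K.X a ⟶ K.X b := fun a b => if e : b + 1 = a then
    eqToHom (by rw [e]) ≫ r (b + 1) ≫ s b else 0
  have hh1 : ∀ b, hh (b + 1) b = r (b + 1) ≫ s b := fun b => by simp [hh]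
  refine ⟨⟨hh, fun i j hij => dif_neg hij, fun j => ?_⟩⟩
  obtain ⟨i, rfl⟩ : ∃ i, j = i + 1 := ⟨j - 1, by ring⟩
  rw [dNext_eq hh (show (ComplexShape.up ℤ).Rel (i + 1) (i + 1 + 1) by simp),
    prevD_eq hh (show (ComplexShape.up ℤ).Rel i (i + 1) by simp), hh1, hh1, ← hd, ← hd]
  have e1 : (π (i + 1) ≫ ι (i + 1 + 1)) ≫ r (i + 1 + 1) ≫ s (i + 1) = π (i + 1) ≫ s (i + 1) := by
    rw [Category.assoc, reassoc_of% (h1 (i + 1 + 1))]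
  have e2 : (r (i + 1) ≫ s i) ≫ π i ≫ ι (i + 1) = r (i + 1) ≫ ι (i + 1) := by
    rw [Category.assoc, reassoc_of% (h2 i)]
  rw [e1, e2]
  simp [← h3 (i + 1), add_comm]

lemma acyclicWith_exSeq_iff (K : CochainComplex (MF n W) ℤ) :
    AcyclicWith (exSeq n W) K ↔ ∀ i, Nonempty (Homotopy (𝟙 (comp K i)) 0) := by
  constructor
  · rintro ⟨Z, ι, π, w, hd, h⟩ i
    choose r s h1 h2 h3 using fun j => (h j).data i
    exact exists_homotopy_of_splitting (comp K i) (fun j => (Z j).X i) (fun j => (ι j).f i)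
      (fun j => (π j).f i) r s (fun j => congrArg (fun φ => MF.Hom.f φ i) (hd j)) h1 h2 h3
  · intro h
    apply acyclicWith_of_components
    intro j l hl w i
    obtain ⟨H⟩ := h i
    have hj := H.comm (j + 1)
    have e1 := dNext_eq H.hom (show (ComplexShape.up ℤ).Rel (j + 1) (j + 1 + 1) by simp)
    have e2 := prevD_eq H.hom (show (ComplexShape.up ℤ).Rel j (j + 1) by simp)
    rw [e1, e2] at hj
    let l' : (K.X j).X i ⟶ kernel ((K.d (j + 1) (j + 1 + 1)).f i) := l.f i
    have hl' : l' ≫ kernel.ι ((K.d (j + 1) (j + 1 + 1)).f i) = (K.d j (j + 1)).f i :=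
      congrArg (fun φ => MF.Hom.f φ i) hl
    exact ⟨ShortComplex.Splitting.ofExactOfSection _ (kernel_lift_exact _ _ l' hl') _
      (kernel_lift_section _ _ l' hl' (H.hom (j + 1) j) (H.hom _ _) hj)
      (mono_kerι _ i)⟩

lemma acyclicWith_abSeq_iff (K : CochainComplex (MF n W) ℤ) :
    AcyclicWith (abSeq n W) K ↔ ∀ i, (comp K i).Acyclic := by
  constructor
  · rintro ⟨Z, ι, π, w, hd, h⟩ i j
    obtain ⟨j, rfl⟩ : ∃ i, j = i + 1 := ⟨j - 1, by ring⟩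
    rw [HomologicalComplex.exactAt_iff' _ j (j + 1) (j + 1 + 1) (by simp) (by simp)]
    have hepi : Epi ((π j).f i) := (h j i).epi_g
    have hmono : Mono ((ι (j + 1 + 1)).f i) := (h (j + 1 + 1) i).mono_f
    exact exact_glue ((π j).f i) ((ι (j + 1)).f i) ((π (j + 1)).f i)
      ((ι (j + 1 + 1)).f i) _ (h (j + 1) i).exact _ _
      (congrArg (fun φ => MF.Hom.f φ i) (hd j)) (congrArg (fun φ => MF.Hom.f φ i) (hd (j + 1))) _
  · intro h
    apply acyclicWith_of_components
    intro j l hl w i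
    let l' : (K.X j).X i ⟶ kernel ((K.d (j + 1) (j + 1 + 1)).f i) := l.f i
    have hl' : l' ≫ kernel.ι ((K.d (j + 1) (j + 1 + 1)).f i) = (K.d j (j + 1)).f i :=
      congrArg (fun φ => MF.Hom.f φ i) hl
    have hex := h i (j + 1)
    rw [HomologicalComplex.exactAt_iff' _ j (j + 1) (j + 1 + 1) (by simp) (by simp)] at hex
    exact ShortComplex.ShortExact.mk' (kernel_lift_exact _ _ l' hl')
      (mono_kerι _ i) (kernel_lift_epi _ _ _ l' hl' hex)

end Acyclic

section Bounded

variable (A : Type u) [Category.{v} A] [Preadditive A]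

/-- The bounded complexes, as objects of the homotopy category. -/
def bounded : ObjectProperty (HomotopyCategory A (.up ℤ)) :=
  fun K => ∃ a b : ℤ, CochainComplex.IsStrictlyGE K.as a ∧ CochainComplex.IsStrictlyLE K.as b

variable {A} in
lemma bounded_quotient_obj_iff (K : CochainComplex A ℤ) :
    bounded A ((HomotopyCategory.quotient _ _).obj K) ↔
      ∃ a b : ℤ, K.IsStrictlyGE a ∧ K.IsStrictlyLE b := Iff.rfl

instance [HasZeroObject A] : (bounded A).ContainsZero where
  exists_zero :=
    ⟨(HomotopyCategory.quotient _ _).obj 0, Functor.map_isZero _ (isZero_zero _),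
      0, 0, inferInstanceAs (CochainComplex.IsStrictlyGE (0 : CochainComplex A ℤ) 0),
      inferInstanceAs (CochainComplex.IsStrictlyLE (0 : CochainComplex A ℤ) 0)⟩

instance : (bounded A).IsStableUnderShift ℤ where
  isStableUnderShiftBy n :=
    { le_shift K hK := by
        obtain ⟨K : CochainComplex _ _, rfl⟩ := K.quotient_obj_surjective
        rw [bounded_quotient_obj_iff] at hK
        obtain ⟨a, b, _, _⟩ := hK
        rw [ObjectProperty.prop_shift_iff, HomotopyCategory.shift_quotient_obj,
          bounded_quotient_obj_iff]
        exact ⟨a - n, b - n, K.isStrictlyGE_shift a n (a - n) (by lia),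
          K.isStrictlyLE_shift b n (b - n) (by lia)⟩ }

variable {A} in
lemma isStrictlyLE_mappingCone [HasBinaryBiproducts A] {K L : CochainComplex A ℤ} (f : K ⟶ L)
    (n₁ n₂ n : ℤ) [K.IsStrictlyLE n₁] [L.IsStrictlyLE n₂] (hn₁ : n₁ ≤ n + 1) (hn₂ : n₂ ≤ n) :
    (CochainComplex.mappingCone f).IsStrictlyLE n := by
  rw [CochainComplex.isStrictlyLE_iff]
  intro i hi
  rw [CochainComplex.mappingCone.isZero_X_iff]
  exact ⟨K.isZero_of_isStrictlyLE n₁ _ (by lia), L.isZero_of_isStrictlyLE n₂ _ (by lia)⟩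

instance [HasZeroObject A] [HasBinaryBiproducts A] :
    (bounded A).IsTriangulatedClosed₃ where
  ext₃' T hT h₁ h₂ := by
    obtain ⟨a₁, b₁, _, _⟩ := h₁
    obtain ⟨a₂, b₂, _, _⟩ := h₂
    obtain ⟨f : T.obj₁.as ⟶ T.obj₂.as, hf⟩ :=
      (HomotopyCategory.quotient _ _).map_surjective T.mor₁
    refine ⟨_, ?_,
      ⟨Triangle.π₃.mapIso (isoTriangleOfIso₁₂ T _ hT
        (HomotopyCategory.mappingCone_triangleh_distinguished f)
        (Iso.refl _) (Iso.refl _) ?_)⟩⟩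
    · exact ⟨min (a₁ - 1) a₂, max (b₁ - 1) b₂,
        CochainComplex.isStrictlyGE_mappingCone f a₁ a₂ _ (by simp) (by simp),
        isStrictlyLE_mappingCone f b₁ b₂ _ (by lia) (by lia)⟩
    · exact (Category.comp_id _).trans (hf.symm.trans (Category.id_comp _).symm)

instance [HasZeroObject A] [HasBinaryBiproducts A] : (bounded A).IsTriangulated where
  toIsTriangulatedClosed₂ := .of_isTriangulatedClosed₃

/-- The bounded homotopy category. -/
abbrev Kb := (bounded A).FullSubcategory

end Bounded

section AcyclicKb

variable {C : Type u} [Category.{v} C] [Abelian C] (n : ℕ) (W : 𝟭 C ⟶ 𝟭 C)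

/-- The bounded complexes of matrix factorizations that are acyclic for the graded-split
exact structure. -/
def exAcyclic : ObjectProperty (Kb (MF n W)) := fun K => AcyclicWith (exSeq n W) K.obj.as

/-- The bounded complexes of matrix factorizations that are acyclic for the abelian exact
structure. -/
def abAcyclic : ObjectProperty (Kb (MF n W)) := fun K => AcyclicWith (abSeq n W) K.obj.as

variable {W} in
/-- The complex of `i`-th components, up to homotopy. -/
noncomputable abbrev compFunctor (i : ZMod n) :
    Kb (MF n W) ⥤ HomotopyCategory C (.up ℤ) :=
  (bounded (MF n W)).ι ⋙ (MF.ev n W i).mapHomotopyCategory (.up ℤ)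

lemma exAcyclic_iff (K : Kb (MF n W)) :
    exAcyclic n W K ↔ ∀ i, IsZero ((compFunctor n i).obj K) := by
  refine (acyclicWith_exSeq_iff _).trans (forall_congr' fun i => ?_)
  exact (HomotopyCategory.isZero_quotient_obj_iff (comp K.obj.as i)).symm

lemma abAcyclic_iff (K : Kb (MF n W)) :
    abAcyclic n W K ↔
      ∀ i, HomotopyCategory.subcategoryAcyclic C ((compFunctor n i).obj K) := by
  refine (acyclicWith_abSeq_iff _).trans (forall_congr' fun i => ?_)
  exact (HomotopyCategory.quotient_obj_mem_subcategoryAcyclic_iff_acyclic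
    (comp K.obj.as i)).symm

instance : (exAcyclic n W).IsClosedUnderIsomorphisms where
  of_iso e h := by
    rw [exAcyclic_iff] at h ⊢
    exact fun i => (h i).of_iso ((compFunctor n i).mapIso e).symm

instance : (abAcyclic n W).IsClosedUnderIsomorphisms where
  of_iso e h := by
    rw [abAcyclic_iff] at h ⊢
    exact fun i => ObjectProperty.prop_of_iso _ ((compFunctor n i).mapIso e) (h i)

instance : (exAcyclic n W).ContainsZero where
  exists_zero := ⟨0, isZero_zero _, (exAcyclic_iff _ _ _).2 fun i =>
    (compFunctor n i).map_isZero (isZero_zero _)⟩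

instance : (abAcyclic n W).ContainsZero where
  exists_zero := ⟨0, isZero_zero _, (abAcyclic_iff _ _ _).2 fun i =>
    ObjectProperty.prop_of_isZero _ ((compFunctor n i).map_isZero (isZero_zero _))⟩

instance : (exAcyclic n W).IsStableUnderShift ℤ where
  isStableUnderShiftBy a :=
    { le_shift K hK := by
        rw [ObjectProperty.prop_shift_iff]
        rw [exAcyclic_iff] at hK ⊢
        exact fun i => ((shiftFunctor _ a).map_isZero (hK i)).of_iso
          (((compFunctor n i).commShiftIso a).app K) }

instance : (abAcyclic n W).IsStableUnderShift ℤ where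
  isStableUnderShiftBy a :=
    { le_shift K hK := by
        rw [ObjectProperty.prop_shift_iff]
        rw [abAcyclic_iff] at hK ⊢
        exact fun i => ObjectProperty.prop_of_iso _
          (((compFunctor n i).commShiftIso a).app K).symm
          (ObjectProperty.le_shift _ a _ (hK i)) }

instance : (exAcyclic n W).IsTriangulated where
  toIsTriangulatedClosed₂ := .mk' fun T hT h₁ h₃ => by
    rw [exAcyclic_iff] at h₁ h₃ ⊢
    exact fun i => Triangle.isZero₂_of_isZero₁₃ _
      ((compFunctor n i).map_distinguished T hT) (h₁ i) (h₃ i)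

instance : (abAcyclic n W).IsTriangulated where
  toIsTriangulatedClosed₂ := .mk' fun T hT h₁ h₃ => by
    rw [abAcyclic_iff] at h₁ h₃ ⊢
    exact fun i => ObjectProperty.ext_of_isTriangulatedClosed₂ _ _
      ((compFunctor n i).map_distinguished T hT) (h₁ i) (h₃ i)

lemma exAcyclic_le_abAcyclic : exAcyclic n W ≤ abAcyclic n W := by
  intro K hK
  rw [exAcyclic_iff] at hK
  rw [abAcyclic_iff]
  exact fun i => ObjectProperty.prop_of_isZero _ (hK i)

end AcyclicKb

section Stab

variable {E : Type u} [Category.{v} E] [Preadditive E]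

/-- Two morphisms are identified in the stable category when their difference factors through a
projective-injective object. -/
def stabRel (S : ObjectProperty (ShortComplex E)) : HomRel E :=
  fun X Y f g => ∃ (P : E) (_ : ProjInj S P) (a : X ⟶ P) (b : P ⟶ Y), f - g = a ≫ b

variable (S : ObjectProperty (ShortComplex E))

lemma projInj_of_isZero {P : E} (hP : IsZero P) : ProjInj S P :=
  ⟨fun _ _ _ => ⟨0, hP.eq_of_src _ _⟩, fun _ _ _ => ⟨0, hP.eq_of_tgt _ _⟩⟩

lemma projInj_zero [HasZeroObject E] : ProjInj S (0 : E) :=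
  projInj_of_isZero S (isZero_zero E)

lemma projInj_biprod [HasBinaryBiproducts E] {P Q : E} (hP : ProjInj S P) (hQ : ProjInj S Q) :
    ProjInj S (P ⊞ Q) := by
  constructor
  · intro T hT f
    obtain ⟨a, ha⟩ := hP.1 T hT (biprod.inl ≫ f)
    obtain ⟨b, hb⟩ := hQ.1 T hT (biprod.inr ≫ f)
    exact ⟨biprod.desc a b, by ext <;> simp [ha, hb]⟩
  · intro T hT f
    obtain ⟨a, ha⟩ := hP.2 T hT (f ≫ biprod.fst)
    obtain ⟨b, hb⟩ := hQ.2 T hT (f ≫ biprod.snd)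
    exact ⟨biprod.lift a b, by ext <;> simp [ha, hb]⟩

variable [HasZeroObject E] [HasBinaryBiproducts E]

instance : Congruence (stabRel S) where
  equivalence :=
    { refl := fun f => ⟨0, projInj_zero S, 0, 0, by simp⟩
      symm := by
        rintro f g ⟨P, hP, a, b, h⟩
        exact ⟨P, hP, -a, b, by rw [Preadditive.neg_comp, ← h, neg_sub]⟩
      trans := by
        rintro f g k ⟨P, hP, a, b, h⟩ ⟨P', hP', a', b', h'⟩
        exact ⟨P ⊞ P', projInj_biprod S hP hP', biprod.lift a a', biprod.desc b b', by
          rw [biprod.lift_desc, ← h, ← h']; abel⟩ }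
  comp_left := by
    rintro X Y Z f g k ⟨P, hP, a, b, h⟩
    exact ⟨P, hP, f ≫ a, b, by rw [Category.assoc, ← h, Preadditive.comp_sub]⟩
  comp_right := by
    rintro X Y Z f g k ⟨P, hP, a, b, h⟩
    exact ⟨P, hP, a, b ≫ k, by rw [← Category.assoc, ← h, Preadditive.sub_comp]⟩

/-- The stable category: the quotient by the morphisms that factor through a
projective-injective object. -/
abbrev Stab := Quotient (stabRel S)

set_option linter.unusedSectionVars false in
lemma stabRel_add {X Y : E} {f₁ f₂ g₁ g₂ : X ⟶ Y} (hf : stabRel S f₁ f₂) (hg : stabRel S g₁ g₂) :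
    stabRel S (f₁ + g₁) (f₂ + g₂) := by
  obtain ⟨P, hP, a, b, h⟩ := hf
  obtain ⟨P', hP', a', b', h'⟩ := hg
  exact ⟨P ⊞ P', projInj_biprod S hP hP', biprod.lift a a', biprod.desc b b', by
    rw [biprod.lift_desc, ← h, ← h']; abel⟩

noncomputable instance : Preadditive (Stab S) :=
  Quotient.preadditive (stabRel S) fun _ _ _ _ _ _ hf hg => stabRel_add S hf hg

instance : (Quotient.functor (stabRel S)).Additive :=
  Quotient.functor_additive (stabRel S) fun _ _ _ _ _ _ hf hg => stabRel_add S hf hg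

end Stab


section StableEmbedding

set_option linter.unusedSectionVars false

variable {E : Type*} [Category E] [Preadditive E] [HasZeroObject E] [HasBinaryBiproducts E]
  (S : ObjectProperty (ShortComplex E))
  {D : Type*} [Category D] [Preadditive D] [HasZeroObject D] [HasShift D ℤ]
  [∀ a : ℤ, (shiftFunctor D a).Additive] [Pretriangulated D]
  (ι : E ⥤ D) [ι.Additive]

/-- Every object is the target of an admissible epimorphism from a projective-injective. -/
abbrev EnoughProj : Prop :=
  ∀ M : E, ∃ (K P : E) (i : K ⟶ P) (p : P ⟶ M) (w : i ≫ p = 0),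
    S (ShortComplex.mk i p w) ∧ ProjInj S P

/-- Every object is the source of an admissible monomorphism to a projective-injective. -/
abbrev EnoughInj : Prop :=
  ∀ M : E, ∃ (I K : E) (i : M ⟶ I) (p : I ⟶ K) (w : i ≫ p = 0),
    S (ShortComplex.mk i p w) ∧ ProjInj S I

/-- Every morphism becomes an admissible monomorphism after adding a projective-injective to its
target. -/
abbrev EnoughCones : Prop :=
  ∀ {X Y : E} (f : X ⟶ Y), ∃ (I Z : E) (j : X ⟶ Y ⊞ I) (g : Y ⊞ I ⟶ Z) (w : j ≫ g = 0),
    S (ShortComplex.mk j g w) ∧ ProjInj S I ∧ j ≫ biprod.fst = f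

/-- Admissible short exact sequences become distinguished triangles. -/
abbrev MakesTriangles : Prop :=
  ∀ T : ShortComplex E, S T → ∃ δ : ι.obj T.X₃ ⟶ (ι.obj T.X₁)⟦(1 : ℤ)⟧,
    Triangle.mk (ι.map T.f) (ι.map T.g) δ ∈ distTriang D

/-- There are no morphisms of positive degree to projective-injectives. -/
abbrev VanishingRight : Prop :=
  ∀ (X P : E), ProjInj S P → ∀ j : ℤ, 0 < j → ∀ f : ι.obj X ⟶ (ι.obj P)⟦j⟧, f = 0

/-- The objects of `E` generate `D` as a triangulated category. -/
abbrev Generates : Prop :=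
  ∀ (Q : ObjectProperty D) [Q.IsTriangulated] [Q.IsClosedUnderIsomorphisms],
    (∀ X, Q (ι.obj X)) → ∀ Z, Q Z

section

variable {X Y Z : D} {f : X ⟶ Y} {g : Y ⟶ Z} {δ : Z ⟶ X⟦(1 : ℤ)⟧}

lemma coyo₁ (h : Triangle.mk f g δ ∈ distTriang D) {A : D} (ψ : A ⟶ X⟦(1 : ℤ)⟧) (h0 : ψ ≫ f⟦(1 : ℤ)⟧' = 0) : ∃ k : A ⟶ Z, ψ = k ≫ δ :=
  Triangle.coyoneda_exact₁ _ h ψ h0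

lemma coyo₂ (h : Triangle.mk f g δ ∈ distTriang D) {A : D} (ψ : A ⟶ Y) (h0 : ψ ≫ g = 0) : ∃ k : A ⟶ X, ψ = k ≫ f :=
  Triangle.coyoneda_exact₂ _ h ψ h0

lemma coyo₃ (h : Triangle.mk f g δ ∈ distTriang D) {A : D} (ψ : A ⟶ Z) (h0 : ψ ≫ δ = 0) : ∃ k : A ⟶ Y, ψ = k ≫ g :=
  Triangle.coyoneda_exact₃ _ h ψ h0

lemma yo₂ (h : Triangle.mk f g δ ∈ distTriang D) {A : D} (ψ : Y ⟶ A) (h0 : f ≫ ψ = 0) : ∃ k : Z ⟶ A, ψ = g ≫ k :=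
  Triangle.yoneda_exact₂ _ h ψ h0

lemma yo₃ (h : Triangle.mk f g δ ∈ distTriang D) {A : D} (ψ : Z ⟶ A) (h0 : g ≫ ψ = 0) : ∃ k : X⟦(1 : ℤ)⟧ ⟶ A, ψ = δ ≫ k :=
  Triangle.yoneda_exact₃ _ h ψ h0

end

lemma shifted_triangle {X Y Z : D} {f : X ⟶ Y} {g : Y ⟶ Z} {δ : Z ⟶ X⟦(1 : ℤ)⟧}
    (h : Triangle.mk f g δ ∈ distTriang D) (N : ObjectProperty D) [N.IsStableUnderShift ℤ]
    (hN : N Y) (m : ℕ) :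
    ∃ d : Z⟦(m : ℤ)⟧ ⟶ X⟦((m + 1 : ℕ) : ℤ)⟧, N.trW d ∧
      (∀ (A : D) (ψ : A ⟶ X⟦((m + 1 : ℕ) : ℤ)⟧),
        (∀ φ : A ⟶ Y⟦((m + 1 : ℕ) : ℤ)⟧, φ = 0) → ∃ k, k ≫ d = ψ) ∧
      ∀ (A : D) (k : A ⟶ Z⟦(m : ℤ)⟧), k ≫ d = 0 → ∃ l : A ⟶ Y⟦(m : ℤ)⟧, k = l ≫ g⟦(m : ℤ)⟧' := by
  let e (A : D) : A⟦(m : ℤ)⟧⟦(1 : ℤ)⟧ ≅ A⟦((m + 1 : ℕ) : ℤ)⟧ :=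
    ((shiftFunctorAdd' D (m : ℤ) 1 ((m + 1 : ℕ) : ℤ) (by simp)).app A).symm
  let ε := (m : ℤ).negOnePow
  obtain ⟨d0, hT⟩ : ∃ d0 : Z⟦(m : ℤ)⟧ ⟶ X⟦(m : ℤ)⟧⟦(1 : ℤ)⟧,
      Triangle.mk (ε • f⟦(m : ℤ)⟧') (ε • g⟦(m : ℤ)⟧') d0 ∈ distTriang D :=
    ⟨_, Triangle.shift_distinguished _ h (m : ℤ)⟩
  refine ⟨d0 ≫ (e X).hom, ?_, fun A ψ hψ => ?_, fun A k hk => ?_⟩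
  · exact (N.trW.cancel_right_of_respectsIso d0 (e X).hom).2 (ObjectProperty.trW.mk' N
      (rot_of_distTriang _ hT) (ObjectProperty.le_shift N _ _ hN))
  · obtain ⟨k, hk⟩ := coyo₁ hT (ψ ≫ (e X).inv) (by
        rw [← cancel_mono (e Y).hom, zero_comp]
        exact hψ _)
    exact ⟨k, by rw [← Category.assoc, ← hk]; simp⟩
  · have hk' : k ≫ d0 = 0 := by
      rw [← cancel_mono (e X).hom, zero_comp, Category.assoc, hk]
    obtain ⟨l, hl⟩ := coyo₃ hT k hk'
    exact ⟨ε • l, by rw [hl, Linear.comp_units_smul, Linear.units_smul_comp]⟩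

lemma cosyzygy_chain
    (hproj : ∀ M : E, ∃ (K P : E) (i : K ⟶ P) (p : P ⟶ M) (w : i ≫ p = 0),
      S (ShortComplex.mk i p w) ∧ ProjInj S P)
    (htri : ∀ T : ShortComplex E, S T → ∃ δ : ι.obj T.X₃ ⟶ (ι.obj T.X₁)⟦(1 : ℤ)⟧,
      Triangle.mk (ι.map T.f) (ι.map T.g) δ ∈ distTriang D)
    (hvan : ∀ (X P : E), ProjInj S P → ∀ j : ℤ, 0 < j → ∀ f : ι.obj X ⟶ (ι.obj P)⟦j⟧, f = 0)
    (N : ObjectProperty D) [N.IsTriangulated] [IsTriangulated D]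
    (hN : ∀ P, ProjInj S P → N (ι.obj P)) (Y : E) (m : ℕ) :
    ∃ (Z : E) (w : ι.obj Y ⟶ (ι.obj Z)⟦(m : ℤ)⟧), N.trW w ∧
      (∀ (X : E) (ψ : ι.obj X ⟶ (ι.obj Z)⟦(m : ℤ)⟧), ∃ φ : ι.obj X ⟶ ι.obj Y, φ ≫ w = ψ) ∧
      (∀ (X : E) (φ : ι.obj X ⟶ ι.obj Y), φ ≫ w = 0 →
        ∃ (P : E) (p : P ⟶ Y) (a : ι.obj X ⟶ ι.obj P), ProjInj S P ∧ φ = a ≫ ι.map p) ∧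
      (m = 0 → ∀ (X P : E) (p : P ⟶ Z) (φ : ι.obj X ⟶ ι.obj Y)
        (a : ι.obj X ⟶ (ι.obj P)⟦(m : ℤ)⟧), φ ≫ w = a ≫ (ι.map p)⟦(m : ℤ)⟧' →
        ∃ (p' : P ⟶ Y) (a' : ι.obj X ⟶ ι.obj P), φ = a' ≫ ι.map p') := by
  induction m with
  | zero =>
    refine ⟨Y, (shiftFunctorZero D ℤ).inv.app _, N.trW_of_isIso _, fun X ψ =>
      ⟨ψ ≫ (shiftFunctorZero D ℤ).hom.app _, by simp⟩, fun X φ h => ?_, fun _ X P p φ a h =>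
        ⟨p, a ≫ (shiftFunctorZero D ℤ).hom.app _, ?_⟩⟩
    · have : φ = 0 := by rwa [← cancel_mono ((shiftFunctorZero D ℤ).inv.app (ι.obj Y)), zero_comp]
      exact ⟨0, 0, 0, projInj_zero S, by simp [this]⟩
    · have e1 : (ι.map p)⟦(0 : ℤ)⟧' ≫ (shiftFunctorZero D ℤ).hom.app (ι.obj Y) =
          (shiftFunctorZero D ℤ).hom.app (ι.obj P) ≫ ι.map p :=
        (shiftFunctorZero D ℤ).hom.naturality (ι.map p)
      have e2 : (shiftFunctorZero D ℤ).inv.app (ι.obj Y) ≫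
        (shiftFunctorZero D ℤ).hom.app (ι.obj Y) = 𝟙 _ := Iso.inv_hom_id_app _ _
      have := congrArg (· ≫ (shiftFunctorZero D ℤ).hom.app (ι.obj Y)) h
      simp only [Category.assoc] at this ⊢
      rw [← e1]
      exact ((Category.comp_id φ).symm.trans (congrArg (φ ≫ ·) e2.symm)).trans this
  | succ m ih =>
    obtain ⟨Z, w, hw, hs, hk, h0⟩ := ih
    obtain ⟨K, P, i, p, e, hS, hP⟩ := hproj Z
    obtain ⟨δ, hδ⟩ := htri _ hS
    obtain ⟨d, hd, h1, h2⟩ := shifted_triangle hδ N (hN P hP) m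
    refine ⟨K, w ≫ d, N.trW.comp_mem _ _ hw hd, fun X ψ => ?_, fun X φ h => ?_, fun h => ?_⟩
    · obtain ⟨g, hg⟩ := h1 _ ψ (hvan X P hP _ (by omega))
      obtain ⟨φ, hφ⟩ := hs X g
      exact ⟨φ, by rw [reassoc_of% hφ, hg]⟩
    · obtain ⟨g, hg⟩ := h2 _ (φ ≫ w) (by rw [Category.assoc, h])
      rcases Nat.eq_zero_or_pos m with hm | hm
      · obtain ⟨p', a', h'⟩ := h0 hm X P p φ g hg
        exact ⟨P, p', a', hP, h'⟩
      · refine hk X φ ?_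
        rw [hg, hvan X P hP _ (by omega) g, zero_comp]
    · omega


section Main

variable
    (N : ObjectProperty D) [N.IsTriangulated] [IsTriangulated D]
    {V : Type*} [Category V] [Preadditive V] [HasZeroObject V] [HasShift V ℤ]
    [∀ a : ℤ, (shiftFunctor V a).Additive] [Pretriangulated V]
    (L : D ⥤ V) [L.IsLocalization N.trW] [L.CommShift ℤ] [L.IsTriangulated]

lemma exists_factor
    (hproj : EnoughProj S)
    (htri : MakesTriangles S ι)
    (hvan : VanishingRight S ι)
    (hN : ∀ P, ProjInj S P → N (ι.obj P))
    (hN' : ∀ Z, N Z → ∃ m₀ : ℕ, ∀ m : ℕ, m₀ ≤ m →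
      ∀ (Y : E) (f : Z ⟶ (ι.obj Y)⟦(m : ℤ)⟧), f = 0) {Y : E} {C : D} (s : ι.obj Y ⟶ C) (hs : N.trW s) :
    ∃ (B : D) (u : C ⟶ B), N.trW (s ≫ u) ∧
      (∀ (X : E) (ψ : ι.obj X ⟶ B), ∃ φ : ι.obj X ⟶ ι.obj Y, φ ≫ s ≫ u = ψ) ∧
      (∀ (X : E) (φ : ι.obj X ⟶ ι.obj Y), φ ≫ s ≫ u = 0 →
        ∃ (P : E) (p : P ⟶ Y) (a : ι.obj X ⟶ ι.obj P), ProjInj S P ∧ φ = a ≫ ι.map p) := by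
  obtain ⟨Z, a, b, hT, hZ⟩ := (ObjectProperty.trW_iff' N s).1 hs
  obtain ⟨m₀, hm⟩ := hN' Z hZ
  obtain ⟨Y', w, hw, h1, h2, -⟩ := cosyzygy_chain S ι hproj htri hvan N hN Y m₀
  obtain ⟨u, rfl⟩ := yo₂ hT w (hm _ le_rfl _ _)
  exact ⟨_, u, hw, h1, h2⟩

lemma comp_full
    (hproj : EnoughProj S)
    (htri : MakesTriangles S ι)
    (hvan : VanishingRight S ι)
    (hN : ∀ P, ProjInj S P → N (ι.obj P))
    (hN' : ∀ Z, N Z → ∃ m₀ : ℕ, ∀ m : ℕ, m₀ ≤ m →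
      ∀ (Y : E) (f : Z ⟶ (ι.obj Y)⟦(m : ℤ)⟧), f = 0) [ι.Full] : (ι ⋙ L).Full where
  map_surjective {X Y} α := by
    obtain ⟨φ, hφ⟩ := Localization.exists_leftFraction L N.trW α
    obtain ⟨B, u, hu, h1, -⟩ := exists_factor S ι N hproj htri hvan hN hN' φ.s φ.hs
    obtain ⟨ψ, hψ⟩ := h1 X (φ.f ≫ u)
    refine ⟨ι.preimage ψ, ?_⟩
    have : IsIso (L.map (φ.s ≫ u)) := Localization.inverts L N.trW _ hu
    have e1 : α ≫ L.map φ.s = L.map φ.f := by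
      rw [hφ]; exact φ.map_comp_map_s L (Localization.inverts L N.trW)
    rw [← cancel_mono (L.map (φ.s ≫ u)), Functor.comp_map, ι.map_preimage, ← L.map_comp, hψ,
      L.map_comp, L.map_comp, reassoc_of% e1]

lemma comp_map_eq
    (hproj : EnoughProj S)
    (htri : MakesTriangles S ι)
    (hvan : VanishingRight S ι)
    (hN : ∀ P, ProjInj S P → N (ι.obj P))
    (hN' : ∀ Z, N Z → ∃ m₀ : ℕ, ∀ m : ℕ, m₀ ≤ m →
      ∀ (Y : E) (f : Z ⟶ (ι.obj Y)⟦(m : ℤ)⟧), f = 0) [ι.Full] [ι.Faithful] {X Y : E} {f g : X ⟶ Y}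
    (h : (ι ⋙ L).map f = (ι ⋙ L).map g) : stabRel S f g := by
  obtain ⟨C, s, hs, e⟩ := (MorphismProperty.map_eq_iff_postcomp L N.trW (ι.map f) (ι.map g)).1 h
  obtain ⟨B, u, hu, -, h2⟩ := exists_factor S ι N hproj htri hvan hN hN' s hs
  obtain ⟨P, p, a, hP, h3⟩ := h2 X (ι.map (f - g)) (by
    rw [ι.map_sub, Preadditive.sub_comp, reassoc_of% e, sub_self])
  exact ⟨P, hP, ι.preimage a, p, ι.map_injective (by rw [h3, ι.map_comp, ι.map_preimage])⟩

lemma isZero_obj_of_prop {Z : D} (hZ : N Z) : IsZero (L.obj Z) := by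
  have h : N.trW (0 : (0 : D) ⟶ Z) := ⟨_, _, _, contractible_distinguished₁ Z, hZ⟩
  have : IsIso (L.map (0 : (0 : D) ⟶ Z)) := Localization.inverts L N.trW _ h
  exact (L.map_isZero (isZero_zero D)).of_iso (asIso (L.map (0 : (0 : D) ⟶ Z))).symm

/-- The objects of `D` that are isomorphic in `V` to an object coming from `E`. -/
def stableImage : ObjectProperty D := fun Z => ∃ X : E, Nonempty ((ι ⋙ L).obj X ≅ L.obj Z)

instance : (stableImage ι L).IsClosedUnderIsomorphisms where
  of_iso e h := by
    obtain ⟨X, ⟨f⟩⟩ := h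
    exact ⟨X, ⟨f ≪≫ L.mapIso e⟩⟩

lemma stableImage_shift_neg
    (hproj : EnoughProj S)
    (htri : MakesTriangles S ι)
    (hN : ∀ P, ProjInj S P → N (ι.obj P)) {Z : D} (h : stableImage ι L Z) :
    stableImage ι L (Z⟦(-1 : ℤ)⟧) := by
  obtain ⟨X, ⟨e⟩⟩ := h
  obtain ⟨K, P, i, p, w, hS, hP⟩ := hproj X
  obtain ⟨δ, hδ⟩ := htri _ hS
  have h1 : IsIso (L.map δ) := Localization.inverts L N.trW _
    (ObjectProperty.trW.mk' N (rot_of_distTriang _ hδ) (hN _ hP))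
  refine ⟨K, ⟨?_⟩⟩
  let e1 : (L.obj (ι.obj K))⟦(1 : ℤ)⟧ ≅ L.obj Z :=
    ((L.commShiftIso (1 : ℤ)).app (ι.obj K)).symm ≪≫ (asIso (L.map δ)).symm ≪≫ e
  exact (shiftShiftNeg (L.obj (ι.obj K)) (1 : ℤ)).symm ≪≫
    (shiftFunctor V (-1 : ℤ)).mapIso e1 ≪≫ ((L.commShiftIso (-1 : ℤ)).app Z).symm

lemma stableImage_shift
    (hinj : EnoughInj S)
    (htri : MakesTriangles S ι)
    (hN : ∀ P, ProjInj S P → N (ι.obj P)) {Z : D} (h : stableImage ι L Z) :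
    stableImage ι L (Z⟦(1 : ℤ)⟧) := by
  obtain ⟨X, ⟨e⟩⟩ := h
  obtain ⟨I, K, i, p, w, hS, hP⟩ := hinj X
  obtain ⟨δ, hδ⟩ := htri _ hS
  have h1 : IsIso (L.map δ) := Localization.inverts L N.trW _
    (ObjectProperty.trW.mk' N (rot_of_distTriang _ hδ) (hN _ hP))
  exact ⟨K, ⟨asIso (L.map δ) ≪≫ (L.commShiftIso (1 : ℤ)).app (ι.obj X) ≪≫
    (shiftFunctor V (1 : ℤ)).mapIso e ≪≫ ((L.commShiftIso (1 : ℤ)).app Z).symm⟩⟩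

lemma stableImage_stable
    (hproj : EnoughProj S)
    (hinj : EnoughInj S)
    (htri : MakesTriangles S ι)
    (hN : ∀ P, ProjInj S P → N (ι.obj P)) : (stableImage ι L).IsStableUnderShift ℤ where
  isStableUnderShiftBy a :=
    { le_shift := fun Z hZ => by
        rw [ObjectProperty.prop_shift_iff]
        induction a using Int.induction_on with
        | zero => exact ObjectProperty.prop_of_iso _ ((shiftFunctorZero D ℤ).app Z).symm hZ
        | succ k ih =>
          exact ObjectProperty.prop_of_iso _
            ((shiftFunctorAdd' D (k : ℤ) 1 (k + 1) rfl).app Z).symm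
            (stableImage_shift S ι N L hinj htri hN ih)
        | pred k ih =>
          exact ObjectProperty.prop_of_iso _
            ((shiftFunctorAdd' D (-k : ℤ) (-1) (-k - 1) rfl).app Z).symm
            (stableImage_shift_neg S ι N L hproj htri hN ih) }

lemma stableImage_closed₃
    (hcone : EnoughCones S)
    (htri : MakesTriangles S ι)
    (hN : ∀ P, ProjInj S P → N (ι.obj P)) [(ι ⋙ L).Full] : (stableImage ι L).IsTriangulatedClosed₃ := by
  refine .mk' fun T hT h₁ h₂ => ?_
  obtain ⟨X, ⟨e⟩⟩ := h₁
  obtain ⟨Y, ⟨e'⟩⟩ := h₂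
  obtain ⟨f, hf⟩ := (ι ⋙ L).map_surjective (e.hom ≫ L.map T.mor₁ ≫ e'.inv)
  obtain ⟨I, Z, j, g, w, hS, hI, hj⟩ := hcone f
  obtain ⟨δ, hδ⟩ := htri _ hS
  have hL : L.Additive := inferInstance
  have h0 : (ι ⋙ L).map (𝟙 I) = 0 := (isZero_obj_of_prop N L (hN I hI)).eq_of_src _ _
  have hfst : (ι ⋙ L).map (biprod.fst : Y ⊞ I ⟶ Y) ≫ (ι ⋙ L).map biprod.inl = 𝟙 _ := by
    rw [← Functor.map_comp, ← (ι ⋙ L).map_id, ← biprod.total, Functor.map_add]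
    have : (ι ⋙ L).map (biprod.snd ≫ biprod.inr : Y ⊞ I ⟶ Y ⊞ I) = 0 := by
      rw [← Category.id_comp biprod.inr, Functor.map_comp, Functor.map_comp, h0]; simp
    rw [this, add_zero]
  let b : (ι ⋙ L).obj (Y ⊞ I) ≅ (ι ⋙ L).obj Y :=
    ⟨(ι ⋙ L).map biprod.fst, (ι ⋙ L).map biprod.inl, hfst, by
      rw [← Functor.map_comp]; simp⟩
  have t := isoTriangleOfIso₁₂ _ _ (L.map_distinguished _ hδ) (L.map_distinguished _ hT)
    e (b ≪≫ e') (by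
      change (ι ⋙ L).map j ≫ (ι ⋙ L).map biprod.fst ≫ e'.hom = e.hom ≫ L.map T.mor₁
      rw [← Functor.map_comp_assoc, hj, hf]
      simp)
  exact ⟨Z, ⟨Triangle.π₃.mapIso t⟩⟩

lemma comp_essSurj
    (hproj : EnoughProj S)
    (hinj : EnoughInj S)
    (hcone : EnoughCones S)
    (htri : MakesTriangles S ι)
    (hvan : VanishingRight S ι)
    (hgen : Generates ι)
    (hN : ∀ P, ProjInj S P → N (ι.obj P))
    (hN' : ∀ Z, N Z → ∃ m₀ : ℕ, ∀ m : ℕ, m₀ ≤ m →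
      ∀ (Y : E) (f : Z ⟶ (ι.obj Y)⟦(m : ℤ)⟧), f = 0) [ι.Full] : (ι ⋙ L).EssSurj where
  mem_essImage Z := by
    have := comp_full S ι N L hproj htri hvan hN hN'
    have := stableImage_stable S ι N L hproj hinj htri hN
    have := stableImage_closed₃ S ι N L hcone htri hN
    have h0 : (stableImage ι L).ContainsZero :=
      ⟨⟨ι.obj 0, ι.map_isZero (isZero_zero E), 0, ⟨Iso.refl _⟩⟩⟩
    have : (stableImage ι L).IsTriangulated :=
      { toIsTriangulatedClosed₂ := .of_isTriangulatedClosed₃ }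
    have := Localization.essSurj L N.trW
    obtain ⟨X, ⟨e⟩⟩ := hgen (stableImage ι L) (fun X => ⟨X, ⟨Iso.refl _⟩⟩) (L.objPreimage Z)
    exact ⟨X, ⟨e ≪≫ L.objObjPreimageIso Z⟩⟩

lemma map_eq_of_stabRel
    (hN : ∀ P, ProjInj S P → N (ι.obj P)) {X Y : E} {f g : X ⟶ Y} (h : stabRel S f g) :
    (ι ⋙ L).map f = (ι ⋙ L).map g := by
  obtain ⟨P, hP, a, b, h⟩ := h
  have hL : L.Additive := inferInstance
  have h0 : (ι ⋙ L).map a = 0 := (isZero_obj_of_prop N L (hN P hP)).eq_of_tgt _ _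
  rw [← sub_eq_zero, ← Functor.map_sub, h, Functor.map_comp, h0, zero_comp]

lemma isEquivalence_lift
    (hproj : EnoughProj S)
    (hinj : EnoughInj S)
    (hcone : EnoughCones S)
    (htri : MakesTriangles S ι)
    (hvan : VanishingRight S ι)
    (hgen : Generates ι)
    (hN : ∀ P, ProjInj S P → N (ι.obj P))
    (hN' : ∀ Z, N Z → ∃ m₀ : ℕ, ∀ m : ℕ, m₀ ≤ m →
      ∀ (Y : E) (f : Z ⟶ (ι.obj Y)⟦(m : ℤ)⟧), f = 0) [ι.Full] [ι.Faithful] :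
    (CategoryTheory.Quotient.lift (stabRel S) (ι ⋙ L)
      (fun _ _ _ _ h => map_eq_of_stabRel S ι N L hN h)).IsEquivalence :=
  have := comp_full S ι N L hproj htri hvan hN hN'
  have := comp_essSurj S ι N L hproj hinj hcone htri hvan hgen hN hN'
  { full :=
      { map_surjective := by
          rintro ⟨X⟩ ⟨Y⟩ α
          obtain ⟨f, hf⟩ := (ι ⋙ L).map_surjective (X := X) (Y := Y) α
          exact ⟨(Quotient.functor _).map f, hf⟩ }
    faithful :=
      { map_injective := by
          rintro ⟨X⟩ ⟨Y⟩ α β h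
          obtain ⟨f, rfl⟩ := (Quotient.functor (stabRel S)).map_surjective (X := X) (Y := Y) α
          obtain ⟨g, rfl⟩ := (Quotient.functor (stabRel S)).map_surjective (X := X) (Y := Y) β
          exact CategoryTheory.Quotient.sound _ (comp_map_eq S ι N L hproj htri hvan hN hN' h) }
    essSurj :=
      { mem_essImage := fun Z =>
          ⟨(Quotient.functor _).obj ((ι ⋙ L).objPreimage Z), ⟨(ι ⋙ L).objObjPreimageIso Z⟩⟩ } }

end Main

end StableEmbedding

section DerivedEmbedding

set_option linter.unusedSectionVars false

variable {E : Type*} [Category E] [Preadditive E]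
  (S : ObjectProperty (ShortComplex E))
  {T : Type*} [Category T] [Preadditive T] [HasZeroObject T] [HasShift T ℤ]
  [∀ a : ℤ, (shiftFunctor T a).Additive] [Pretriangulated T] [IsTriangulated T]
  (ι : E ⥤ T) [ι.Additive]

lemma hom_shift_one_eq_zero {X B : T} (h : ∀ g : X ⟶ B⟦(-1 : ℤ)⟧, g = 0) (f : X⟦(1 : ℤ)⟧ ⟶ B) :
    f = 0 := by
  have h1 := h ((shiftShiftNeg X (1 : ℤ)).inv ≫ f⟦(-1 : ℤ)⟧')
  have h2 : f⟦(-1 : ℤ)⟧' = 0 := by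
    rw [← cancel_epi (shiftShiftNeg X (1 : ℤ)).inv, h1, comp_zero]
  exact (shiftFunctor T (-1 : ℤ)).map_injective (by rw [h2, Functor.map_zero])

lemma hom_shift_eq_zero {X B : T} (a b c : ℤ) (hab : b + a = c)
    (h : ∀ g : X ⟶ B⟦c⟧, g = 0) (f : X ⟶ B⟦b⟧⟦a⟧) : f = 0 := by
  rw [← cancel_mono ((shiftFunctorAdd' T b a c hab).inv.app B), zero_comp]
  exact h _

lemma hom_unshift_eq_zero {X B : T} (a : ℤ) (h : ∀ g : X⟦-a⟧ ⟶ B, g = 0) (f : X ⟶ B⟦a⟧) :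
    f = 0 := by
  have h1 := h (f⟦-a⟧' ≫ (shiftShiftNeg B a).hom)
  have h2 : f⟦-a⟧' = 0 := by
    rw [← cancel_mono (shiftShiftNeg B a).hom, h1, zero_comp]
  exact (shiftFunctor T (-a)).map_injective (by rw [h2, Functor.map_zero])

/-- Admissible epimorphisms are epimorphisms. -/
abbrev AdmissibleEpi : Prop :=
  ∀ Q : ShortComplex E, S Q → ∀ {Y : E} (f : Q.X₃ ⟶ Y), Q.g ≫ f = 0 → f = 0

/-- Admissible epimorphisms are cokernels. -/
abbrev AdmissibleDesc : Prop :=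
  ∀ Q : ShortComplex E, S Q → ∀ {Y : E} (f : Q.X₂ ⟶ Y), Q.f ≫ f = 0 → ∃ g, Q.g ≫ g = f

/-- There are no morphisms of nonzero degree between objects of `E`. -/
abbrev DegreeVanishing : Prop :=
  ∀ (X Y : E) (j : ℤ), j ≠ 0 → ∀ f : ι.obj X ⟶ (ι.obj Y)⟦j⟧, f = 0

variable (A : ObjectProperty T)

/-- The cone of an admissible monomorphism is the cokernel up to `A`. -/
abbrev ExtensionCondition : Prop :=
  ∀ Q : ShortComplex E, S Q → ∀ {K : T} (u : ι.obj Q.X₂ ⟶ K)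
    (v : K ⟶ (ι.obj Q.X₁)⟦(1 : ℤ)⟧), Triangle.mk (ι.map Q.f) u v ∈ distTriang T →
    ∀ c : K ⟶ ι.obj Q.X₃, u ≫ c = ι.map Q.g → A.trW c

variable [A.IsTriangulated]
    {D : Type*} [Category D] [Preadditive D] [HasZeroObject D] [HasShift D ℤ]
    [∀ a : ℤ, (shiftFunctor D a).Additive] [Pretriangulated D]
    (L : T ⥤ D) [L.IsLocalization A.trW] [L.CommShift ℤ] [L.IsTriangulated]

lemma triangle_of_ext
    (hext : ExtensionCondition S ι A) (Q : ShortComplex E) (hQ : S Q) :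
    ∃ δ : (ι ⋙ L).obj Q.X₃ ⟶ ((ι ⋙ L).obj Q.X₁)⟦(1 : ℤ)⟧,
      Triangle.mk ((ι ⋙ L).map Q.f) ((ι ⋙ L).map Q.g) δ ∈ distTriang D := by
  obtain ⟨K, u, v, hT⟩ := distinguished_cocone_triangle (ι.map Q.f)
  obtain ⟨c, hc⟩ := yo₂ hT (ι.map Q.g) (by rw [← ι.map_comp, Q.zero, ι.map_zero])
  have h1 := hext Q hQ u v hT c hc.symm
  have : IsIso (L.map c) := Localization.inverts L A.trW _ h1
  refine ⟨inv (L.map c) ≫ L.map v ≫ (L.commShiftIso (1 : ℤ)).hom.app _,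
    isomorphic_distinguished _ (L.map_distinguished _ hT) _ ?_⟩
  refine Triangle.isoMk _ _ (Iso.refl _) (Iso.refl _) (asIso (L.map c)).symm ?_ ?_ ?_
  · exact (Category.comp_id _).trans (Category.id_comp _).symm
  · change L.map (ι.map Q.g) ≫ inv (L.map c) = 𝟙 _ ≫ L.map u
    rw [hc, L.map_comp, Category.assoc, IsIso.hom_inv_id, Category.id_comp, Category.comp_id]
  · change (inv (L.map c) ≫ L.map v ≫ (L.commShiftIso (1 : ℤ)).hom.app _) ≫ (𝟙 _)⟦(1 : ℤ)⟧' =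
      inv (L.map c) ≫ L.map v ≫ (L.commShiftIso (1 : ℤ)).hom.app _
    exact (congrArg (_ ≫ ·) ((shiftFunctor D (1 : ℤ)).map_id _)).trans (Category.comp_id _)

lemma hom_projInj_right
    (hdeg : DegreeVanishing ι)
    (hright : ∀ P, ProjInj S P → ∀ K, A K → ∀ f : K ⟶ ι.obj P, f = 0) (X P : E) (hP : ProjInj S P) (j : ℤ) (hj : j ≠ 0)
    (f : (ι ⋙ L).obj X ⟶ ((ι ⋙ L).obj P)⟦j⟧) : f = 0 := by
  have ho : A.rightOrthogonal ((ι.obj P)⟦j⟧) := fun K g hK =>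
    hom_unshift_eq_zero j (hright P hP _ (A.le_shift _ _ hK)) g
  obtain ⟨g, hg⟩ := (ho.map_bijective_of_isTriangulated L (ι.obj X)).2
    (f ≫ (L.commShiftIso j).inv.app _)
  rw [hdeg X P j hj g, L.map_zero] at hg
  rw [← cancel_mono ((L.commShiftIso j).inv.app (ι.obj P)), zero_comp]
  exact hg.symm

lemma hom_projInj_left
    (hdeg : DegreeVanishing ι)
    (hleft : ∀ P, ProjInj S P → ∀ K, A K → ∀ f : ι.obj P ⟶ K, f = 0) (P Y : E) (hP : ProjInj S P) (j : ℤ) (hj : j ≠ 0)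
    (f : (ι ⋙ L).obj P ⟶ ((ι ⋙ L).obj Y)⟦j⟧) : f = 0 := by
  have ho : A.leftOrthogonal (ι.obj P) := fun K g hK => hleft P hP _ hK g
  obtain ⟨g, hg⟩ := (ho.map_bijective_of_isTriangulated L ((ι.obj Y)⟦j⟧)).2
    (f ≫ (L.commShiftIso j).inv.app _)
  rw [hdeg P Y j hj g, L.map_zero] at hg
  rw [← cancel_mono ((L.commShiftIso j).inv.app (ι.obj Y)), zero_comp]
  exact hg.symm

lemma exists_resolution
    (hproj : EnoughProj S)
    (hepi : AdmissibleEpi S)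
    (hdesc : AdmissibleDesc S)
    (hdeg : DegreeVanishing ι)
    (hleft : ∀ P, ProjInj S P → ∀ K, A K → ∀ f : ι.obj P ⟶ K, f = 0)
    (hext : ExtensionCondition S ι A) [ι.Full] [ι.Faithful] (m : ℕ) (X : E) :
    ∃ (R : T) (r : R ⟶ ι.obj X), A.trW r ∧
      (∀ K, A K → (∀ (Y : E) (f : ι.obj Y ⟶ K⟦-(m : ℤ)⟧), f = 0) → ∀ f : R ⟶ K, f = 0) ∧
      (∀ (Y : E) (φ : ι.obj X ⟶ ι.obj Y), r ≫ φ = 0 → φ = 0) ∧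
      (∀ (Y : E) (f : R ⟶ ι.obj Y), ∃ φ, r ≫ φ = f) ∧
      (∀ (Y : E) (j : ℤ), j < 0 → ∀ f : R ⟶ (ι.obj Y)⟦j⟧, f = 0) := by
  induction m generalizing X with
  | zero =>
    refine ⟨ι.obj X, 𝟙 _, A.trW_of_isIso _, fun K _ h f => ?_, by simp, by simp,
      fun Y j hj => hdeg X Y j hj.ne⟩
    have := h X (f ≫ (shiftFunctorZero T ℤ).inv.app K)
    rwa [← cancel_mono ((shiftFunctorZero T ℤ).inv.app K), zero_comp]
  | succ m ih =>
    obtain ⟨K', P, i, p, w, hS, hP⟩ := hproj X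
    obtain ⟨R', r', hr', h1, h2, h3, h4⟩ := ih K'
    obtain ⟨R, u, d, hR⟩ := distinguished_cocone_triangle (r' ≫ ι.map i)
    obtain ⟨C, u', d', hC⟩ := distinguished_cocone_triangle (ι.map i)
    obtain ⟨q, hq, hq1'⟩ : ∃ q : R ⟶ C, A.trW q ∧ u ≫ q = u' := by
      obtain ⟨q, hq, hq1, -⟩ := MorphismProperty.compatible_with_triangulation (W := A.trW)
        _ _ hR hC r' (𝟙 _) hr' (A.trW.id_mem _) (Category.comp_id _)
      exact ⟨q, hq, hq1.trans (Category.id_comp _)⟩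
    obtain ⟨c, hc⟩ := yo₂ hC (ι.map p) (by rw [← ι.map_comp, w, ι.map_zero])
    have hcW : A.trW c := hext _ hS u' d' hC c hc.symm
    have hur : u ≫ q ≫ c = ι.map p := by rw [← Category.assoc, hq1', hc]
    refine ⟨R, q ≫ c, A.trW.comp_mem _ _ hq hcW, fun K hK h f => ?_, fun Y φ h => ?_,
      fun Y f => ?_, fun Y j hj f => ?_⟩
    · obtain ⟨g, rfl⟩ := yo₃ hR f (hleft P hP K hK _)
      have : g = 0 := hom_shift_one_eq_zero (h1 _ (A.le_shift (-1) _ hK) fun Y =>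
        hom_shift_eq_zero _ _ (-((m + 1 : ℕ) : ℤ)) (by push_cast; ring) (h Y)) g
      rw [this, comp_zero]
    · obtain ⟨φ, rfl⟩ := ι.map_surjective φ
      have h5 : ι.map (p ≫ φ) = 0 := by
        rw [ι.map_comp, ← hur, Category.assoc, h, comp_zero]
      rw [hepi _ hS φ (ι.map_injective (h5.trans (ι.map_zero _ _).symm)), ι.map_zero]
    · obtain ⟨g, hg⟩ := ι.map_surjective (u ≫ f)
      have h5 : (r' ≫ ι.map i) ≫ u = 0 := comp_distTriang_mor_zero₁₂ _ hR
      have h6 : ι.map (i ≫ g) = 0 := h2 Y _ (by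
        rw [ι.map_comp, hg, ← Category.assoc, ← Category.assoc, h5, zero_comp])
      obtain ⟨b, hb⟩ := hdesc _ hS g (ι.map_injective (h6.trans (ι.map_zero _ _).symm))
      have hb' : p ≫ b = g := hb
      obtain ⟨k, hk⟩ := yo₃ hR (f - (q ≫ c) ≫ ι.map b) (by
        rw [Preadditive.comp_sub, ← hg, ← hb', ι.map_comp, ← hur]; simp)
      have : k = 0 := hom_shift_one_eq_zero (h4 Y (-1) (by omega)) k
      rw [this, comp_zero, sub_eq_zero] at hk
      exact ⟨ι.map b, hk.symm⟩
    · obtain ⟨g, rfl⟩ := yo₃ hR f (hdeg P Y j hj.ne _)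
      have : g = 0 := hom_shift_one_eq_zero (hom_shift_eq_zero _ _ (j + (-1)) rfl
        (h4 Y (j + (-1)) (by omega))) g
      rw [this, comp_zero]

lemma exists_resolution_factor
    (hproj : EnoughProj S)
    (hepi : AdmissibleEpi S)
    (hdesc : AdmissibleDesc S)
    (hdeg : DegreeVanishing ι)
    (hleft : ∀ P, ProjInj S P → ∀ K, A K → ∀ f : ι.obj P ⟶ K, f = 0)
    (hext : ExtensionCondition S ι A)
    (hbdd : ∀ K, A K → ∃ m : ℕ, ∀ (X : E) (f : ι.obj X ⟶ K⟦-(m : ℤ)⟧), f = 0) [ι.Full] [ι.Faithful] {X : E} {K : T} (s : K ⟶ ι.obj X)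
    (hs : A.trW s) :
    ∃ (R : T) (t : R ⟶ K), A.trW (t ≫ s) ∧
      (∀ (Y : E) (φ : ι.obj X ⟶ ι.obj Y), (t ≫ s) ≫ φ = 0 → φ = 0) ∧
      (∀ (Y : E) (f : R ⟶ ι.obj Y), ∃ φ, (t ≫ s) ≫ φ = f) := by
  obtain ⟨Z, a, b, hT, hZ⟩ := hs
  obtain ⟨m, hm⟩ := hbdd Z hZ
  obtain ⟨R, r, h0, h1, h2, h3, -⟩ :=
    exists_resolution S ι A hproj hepi hdesc hdeg hleft hext m X
  obtain ⟨t, rfl⟩ := coyo₂ hT r (h1 Z hZ hm _)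
  exact ⟨R, t, h0, h2, h3⟩

lemma derived_full
    (hproj : EnoughProj S)
    (hepi : AdmissibleEpi S)
    (hdesc : AdmissibleDesc S)
    (hdeg : DegreeVanishing ι)
    (hleft : ∀ P, ProjInj S P → ∀ K, A K → ∀ f : ι.obj P ⟶ K, f = 0)
    (hext : ExtensionCondition S ι A)
    (hbdd : ∀ K, A K → ∃ m : ℕ, ∀ (X : E) (f : ι.obj X ⟶ K⟦-(m : ℤ)⟧), f = 0) [ι.Full] [ι.Faithful] : (ι ⋙ L).Full where
  map_surjective {X Y} α := by
    obtain ⟨φ, hφ⟩ := Localization.exists_rightFraction L A.trW α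
    obtain ⟨R, t, h0, -, h2⟩ :=
      exists_resolution_factor S ι A hproj hepi hdesc hdeg hleft hext hbdd φ.s φ.hs
    obtain ⟨ψ, hψ⟩ := h2 Y (t ≫ φ.f)
    refine ⟨ι.preimage ψ, ?_⟩
    have : IsIso (L.map (t ≫ φ.s)) := Localization.inverts L A.trW _ h0
    have e1 : L.map φ.s ≫ α = L.map φ.f := by
      rw [hφ]; exact φ.map_s_comp_map L (Localization.inverts L A.trW)
    rw [← cancel_epi (L.map (t ≫ φ.s)), Functor.comp_map, ι.map_preimage, ← L.map_comp, hψ,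
      L.map_comp, L.map_comp, Category.assoc, e1]

lemma derived_faithful
    (hproj : EnoughProj S)
    (hepi : AdmissibleEpi S)
    (hdesc : AdmissibleDesc S)
    (hdeg : DegreeVanishing ι)
    (hleft : ∀ P, ProjInj S P → ∀ K, A K → ∀ f : ι.obj P ⟶ K, f = 0)
    (hext : ExtensionCondition S ι A)
    (hbdd : ∀ K, A K → ∃ m : ℕ, ∀ (X : E) (f : ι.obj X ⟶ K⟦-(m : ℤ)⟧), f = 0) [ι.Full] [ι.Faithful] : (ι ⋙ L).Faithful where
  map_injective {X Y} f g h := by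
    obtain ⟨K, s, hs, e⟩ := (MorphismProperty.map_eq_iff_precomp L A.trW (ι.map f) (ι.map g)).1 h
    obtain ⟨R, t, -, h1, -⟩ :=
      exists_resolution_factor S ι A hproj hepi hdesc hdeg hleft hext hbdd s hs
    have := h1 Y (ι.map f - ι.map g) (by
      rw [Category.assoc, Preadditive.comp_sub, e, sub_self, comp_zero])
    exact ι.map_injective (sub_eq_zero.1 this)

end DerivedEmbedding

section Devissage

variable {A : Type u} [Category.{v} A] [Preadditive A]

/-- A bounded complex as an object of the bounded homotopy category. -/
abbrev kb (K : CochainComplex A ℤ) (a b : ℤ) (ha : K.IsStrictlyGE a) (hb : K.IsStrictlyLE b) :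
    Kb A := ⟨(HomotopyCategory.quotient _ _).obj K, a, b, ha, hb⟩

lemma exists_truncation (K : CochainComplex A ℤ) [HasZeroObject A] (b : ℤ) :
    ∃ (M L : CochainComplex A ℤ) (f : M ⟶ K) (g : K ⟶ L) (r : ∀ j, K.X j ⟶ M.X j)
      (s : ∀ j, L.X j ⟶ K.X j), f ≫ g = 0 ∧ (∀ j, f.f j ≫ r j = 𝟙 _) ∧
      (∀ j, s j ≫ g.f j = 𝟙 _) ∧ (∀ j, r j ≫ f.f j + g.f j ≫ s j = 𝟙 _) ∧
      (∀ j, j < b → M.X j = 0 ∧ L.X j = K.X j) ∧ (∀ j, b ≤ j → M.X j = K.X j ∧ L.X j = 0) := by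
  have h1 : ∀ j, ∃ (Y Y' : A) (i : Y ⟶ K.X j) (p : K.X j ⟶ Y) (i' : Y' ⟶ K.X j) (p' : K.X j ⟶ Y'),
      i ≫ p = 𝟙 _ ∧ i' ≫ p' = 𝟙 _ ∧ i' ≫ p = 0 ∧ p' ≫ i' + p ≫ i = 𝟙 _ ∧
      (j < b → Y' = 0 ∧ Y = K.X j ∧ p ≫ i = 𝟙 _ ∧ p' = 0 ∧ i' = 0) ∧
      (b ≤ j → Y' = K.X j ∧ Y = 0 ∧ p' ≫ i' = 𝟙 _ ∧ p = 0 ∧ i = 0) := by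
    intro j
    rcases lt_or_ge j b with h | h
    · exact ⟨K.X j, 0, 𝟙 _, 𝟙 _, 0, 0, by simp, (isZero_zero A).eq_of_src _ _, by simp, by simp,
        fun _ => ⟨rfl, rfl, by simp, rfl, rfl⟩, fun h' => absurd h' (by omega)⟩
    · exact ⟨0, K.X j, 0, 0, 𝟙 _, 𝟙 _, (isZero_zero A).eq_of_src _ _, by simp, by simp, by simp,
        fun h' => absurd h' (by omega), fun _ => ⟨rfl, rfl, by simp, rfl, rfl⟩⟩
  choose Y Y' i p i' p' e1 e2 e3 e4 e5 e6 using h1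
  have hp : ∀ x y : ℤ, x + 1 = y → p x ≫ i x ≫ K.d x y ≫ p y = K.d x y ≫ p y := by
    intro x y hxy
    rcases lt_or_ge x b with h | h
    · rw [reassoc_of% (e5 x h).2.2.1]
    · rw [(e6 y (by omega)).2.2.2.1]; simp
  have hi : ∀ x y : ℤ, x + 1 = y → i' x ≫ K.d x y ≫ p' y ≫ i' y = i' x ≫ K.d x y := by
    intro x y hxy
    rcases lt_or_ge x b with h | h
    · rw [(e5 x h).2.2.2.2]; simp
    · rw [(e6 y (by omega)).2.2.1]; simp
  let L : CochainComplex A ℤ :=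
    { X := Y
      d := fun x y => i x ≫ K.d x y ≫ p y
      shape := fun x y h => by rw [K.shape x y h]; simp
      d_comp_d' := fun x y z hxy hyz => by
        have := hp y z hyz
        simp only [Category.assoc, this]
        simp }
  let M : CochainComplex A ℤ :=
    { X := Y'
      d := fun x y => i' x ≫ K.d x y ≫ p' y
      shape := fun x y h => by rw [K.shape x y h]; simp
      d_comp_d' := fun x y z hxy hyz => by
        have := hi x y hxy
        have h2 := congrArg (· ≫ K.d y z ≫ p' z) this
        simp only [Category.assoc] at h2 ⊢
        rw [h2]; simp }
  refine ⟨M, L, { f := i', comm' := fun x y hxy => ?_ }, { f := p, comm' := fun x y hxy => ?_ },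
    p', i, ?_, e2, e1, e4, fun j h => ⟨(e5 j h).1, (e5 j h).2.1⟩,
    fun j h => ⟨(e6 j h).1, (e6 j h).2.1⟩⟩
  · have := hi x y hxy
    change i' x ≫ K.d x y = (i' x ≫ K.d x y ≫ p' y) ≫ i' y
    rw [← this]; simp
  · exact hp x y hxy
  · ext j
    exact e3 j

variable [HasZeroObject A] [HasBinaryBiproducts A]

lemma prop_of_degreewise_split (Q : ObjectProperty (Kb A)) [Q.IsTriangulated]
    [Q.IsClosedUnderIsomorphisms]
    {M K L : CochainComplex A ℤ} (f : M ⟶ K) (g : K ⟶ L) (w : f ≫ g = 0) (r : ∀ j, K.X j ⟶ M.X j)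
    (s : ∀ j, L.X j ⟶ K.X j) (h1 : ∀ j, f.f j ≫ r j = 𝟙 _)
    (h2 : ∀ j, s j ≫ g.f j = 𝟙 _) (h3 : ∀ j, r j ≫ f.f j + g.f j ≫ s j = 𝟙 _)
    (bM : bounded A ((HomotopyCategory.quotient _ _).obj M))
    (bK : bounded A ((HomotopyCategory.quotient _ _).obj K))
    (bL : bounded A ((HomotopyCategory.quotient _ _).obj L))
    (hM : Q ⟨_, bM⟩) (hL : Q ⟨_, bL⟩) : Q ⟨_, bK⟩ := by
  let F : (⟨_, bM⟩ : Kb A) ⟶ ⟨_, bK⟩ :=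
    ObjectProperty.homMk ((HomotopyCategory.quotient A (.up ℤ)).map f)
  obtain ⟨Z, u, v, hT⟩ := distinguished_cocone_triangle F
  have hT' := (bounded A).ι.map_distinguished _ hT
  have hS := (HomotopyCategory.distinguished_iff_iso_trianglehOfDegreewiseSplit
    (CochainComplex.trianglehOfDegreewiseSplit (ShortComplex.mk f g w)
    fun j => { r := r j, s := s j, f_r := h1 j, s_g := h2 j, id := h3 j })).2
    ⟨_, _, ⟨Iso.refl _⟩⟩
  have e := Triangle.π₃.mapIso (isoTriangleOfIso₁₂ _ _ hS hT' (Iso.refl _) (Iso.refl _)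
    ((Category.comp_id _).trans (Category.id_comp _).symm))
  have hZ : Q Z := Q.prop_of_iso ((bounded A).isoMk (X := ⟨_, bL⟩) (Y := Z) e) hL
  exact Q.ext_of_isTriangulatedClosed₂ _ hT hM hZ

/-- An object as a complex concentrated in degree zero. -/
noncomputable def singleKb (A : Type u) [Category.{v} A] [Preadditive A] [HasZeroObject A] :
    A ⥤ Kb A :=
  (bounded A).lift
    (CochainComplex.singleFunctor A 0 ⋙ HomotopyCategory.quotient A (.up ℤ))
    fun X => ⟨0, 0,
      inferInstanceAs (((CochainComplex.singleFunctor A 0).obj X).IsStrictlyGE 0),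
      inferInstanceAs (((CochainComplex.singleFunctor A 0).obj X).IsStrictlyLE 0)⟩

lemma single_iso (K : CochainComplex A ℤ) [K.IsStrictlyGE 0] [K.IsStrictlyLE 0] :
    Nonempty (K ≅ (HomologicalComplex.single A (.up ℤ) 0).obj (K.X 0)) :=
  ⟨{  hom := HomologicalComplex.mkHomToSingle (𝟙 _) (fun i (hi : i + 1 = 0) =>
        (K.isZero_of_isStrictlyGE 0 i (by lia)).eq_of_src _ _)
      inv := HomologicalComplex.mkHomFromSingle (𝟙 _) (fun i (hi : 0 + 1 = i) =>
        (K.isZero_of_isStrictlyLE 0 i (by lia)).eq_of_tgt _ _)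
      hom_inv_id := by
        ext i
        obtain hi | rfl | hi := lt_trichotomy i 0
        · apply (K.isZero_of_isStrictlyGE 0 i (by lia)).eq_of_src
        · exact (congrArg₂ (· ≫ ·) (HomologicalComplex.mkHomToSingle_f _ _)
            (HomologicalComplex.mkHomFromSingle_f _ _)).trans (by simp)
        · apply (K.isZero_of_isStrictlyLE 0 i (by lia)).eq_of_tgt
      inv_hom_id := HomologicalComplex.from_single_hom_ext
        ((congrArg₂ (· ≫ ·) (HomologicalComplex.mkHomFromSingle_f _ _)
          (HomologicalComplex.mkHomToSingle_f _ _)).trans (by simp)) }⟩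

lemma prop_of_concentrated (Q : ObjectProperty (Kb A)) [Q.IsTriangulated]
    [Q.IsClosedUnderIsomorphisms] (cls : ObjectProperty A) (h : ∀ X, cls X → Q ((singleKb A).obj X))
    (K : CochainComplex A ℤ) (b : ℤ) (bK : bounded A ((HomotopyCategory.quotient _ _).obj K))
    (h1 : ∀ j, j ≠ b → IsZero (K.X j)) (h2 : cls (K.X b)) : Q ⟨_, bK⟩ := by
  let K' : CochainComplex A ℤ := K⟦b⟧
  have i1 : K'.IsStrictlyGE 0 := (CochainComplex.isStrictlyGE_iff _ _).2 fun j hj =>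
    h1 (j + b) (by omega)
  have i2 : K'.IsStrictlyLE 0 := (CochainComplex.isStrictlyLE_iff _ _).2 fun j hj =>
    h1 (j + b) (by omega)
  obtain ⟨e⟩ : Nonempty (K' ≅ (HomologicalComplex.single A (.up ℤ) 0).obj (K'.X 0)) :=
    single_iso K'
  have e1 : (⟨_, bK⟩ : Kb A)⟦b⟧ ≅ (singleKb A).obj (K'.X 0) :=
    (bounded A).isoMk (((bounded A).ι.commShiftIso b).app (⟨_, bK⟩ : Kb A) ≪≫
      (((HomotopyCategory.quotient A (.up ℤ)).commShiftIso b).app K).symm ≪≫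
      (HomotopyCategory.quotient A (.up ℤ)).mapIso e)
  have e0 : K'.X 0 = K.X b := congrArg K.X (by omega : 0 + b = b)
  have h3 : Q ((⟨_, bK⟩ : Kb A)⟦b⟧) := Q.prop_of_iso e1.symm (h _ (e0 ▸ h2))
  exact Q.prop_of_iso ((shiftEquiv _ b).unitIso.app (⟨_, bK⟩ : Kb A)).symm (Q.le_shift (-b) _ h3)

lemma devissage (Q : ObjectProperty (Kb A)) [Q.IsTriangulated]
    [Q.IsClosedUnderIsomorphisms] (cls : ObjectProperty A) (h0 : cls 0)
    (h : ∀ X, cls X → Q ((singleKb A).obj X)) (K : Kb A) (hK : ∀ j, cls (K.obj.as.X j)) :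
    Q K := by
  obtain ⟨⟨K : CochainComplex A ℤ⟩, bK⟩ := K
  change ∀ j, cls (HomologicalComplex.X K j) at hK
  obtain ⟨a, b, ha, hb⟩ := id bK
  obtain ⟨m, hm⟩ : ∃ m : ℕ, b ≤ a + m := ⟨(b - a).toNat, by omega⟩
  change K.IsStrictlyGE a at ha
  change K.IsStrictlyLE b at hb
  have hb' : K.IsStrictlyLE (a + m) := CochainComplex.isStrictlyLE_of_le _ _ _ hm
  clear hb hm
  induction m generalizing K with
  | zero =>
    refine prop_of_concentrated Q cls h K a bK (fun j hj => ?_) (hK a)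
    rcases lt_or_gt_of_ne hj with hj | hj
    · exact K.isZero_of_isStrictlyGE a _ hj
    · exact K.isZero_of_isStrictlyLE (a + (0 : ℕ)) _ (by omega)
  | succ m ih =>
    obtain ⟨M, L, f, g, r, s, w, h1, h2, h3, h4, h5⟩ := exists_truncation K (a + m + 1)
    have z0 : IsZero (0 : A) := isZero_zero A
    have zM : ∀ j, j ≠ a + m + 1 → IsZero (M.X j) := fun j hj => by
      rcases lt_or_gt_of_ne hj with hj | hj
      · rw [(h4 j hj).1]; exact z0
      · rw [(h5 j hj.le).1]
        exact K.isZero_of_isStrictlyLE (a + (m + 1 : ℕ)) _ (by push_cast; omega)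
    have M1 : M.IsStrictlyGE (a + m + 1) := (CochainComplex.isStrictlyGE_iff _ _).2 fun j hj =>
      zM j (by omega)
    have M2 : M.IsStrictlyLE (a + m + 1) := (CochainComplex.isStrictlyLE_iff _ _).2 fun j hj =>
      zM j (by omega)
    have L1 : L.IsStrictlyGE a := (CochainComplex.isStrictlyGE_iff _ _).2 fun j hj => by
      rw [(h4 j (by omega)).2]; exact K.isZero_of_isStrictlyGE a _ hj
    have L2 : L.IsStrictlyLE (a + m) := (CochainComplex.isStrictlyLE_iff _ _).2 fun j hj => by
      rw [(h5 j (by omega)).2]; exact z0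
    refine prop_of_degreewise_split Q f g w r s h1 h2 h3 ⟨_, _, M1, M2⟩ bK ⟨_, _, L1, L2⟩ ?_
      (ih L ⟨_, _, L1, L2⟩ (fun j => ?_) L1 L2)
    · refine prop_of_concentrated Q cls h M _ _ zM ?_
      rw [(h5 _ le_rfl).1]
      exact hK _
    · rcases lt_or_ge j (a + m + 1) with hj | hj
      · rw [(h4 j hj).2]; exact hK j
      · rw [(h5 j hj).2]; exact h0

end Devissage

section Degree

variable {A : Type u} [Category.{v} A] [Preadditive A] [HasZeroObject A]

instance : (HomotopyCategory.singleFunctor A 0).Full :=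
  inferInstanceAs (CochainComplex.singleFunctor A 0 ⋙ HomotopyCategory.quotient A _).Full

instance : (HomotopyCategory.singleFunctor A 0).Faithful where
  map_injective {X Y} f g h := by
    have h' : (HomotopyCategory.quotient A (.up ℤ)).map
        ((CochainComplex.singleFunctor A 0).map f) = (HomotopyCategory.quotient A (.up ℤ)).map
        ((CochainComplex.singleFunctor A 0).map g) := h
    have H := HomotopyCategory.homotopyOfEq _ _ h'
    refine (CochainComplex.singleFunctor A 0).map_injective
      (HomologicalComplex.from_single_hom_ext ?_)
    have e := H.comm 0
    have e1 := dNext_eq H.hom (show (ComplexShape.up ℤ).Rel 0 1 by simp)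
    have e2 := prevD_eq H.hom (show (ComplexShape.up ℤ).Rel (-1) 0 by simp)
    have d1 : ((CochainComplex.singleFunctor A 0).obj X).d 0 1 = 0 :=
      HomologicalComplex.single_obj_d ..
    have d2 : ((CochainComplex.singleFunctor A 0).obj Y).d (-1) 0 = 0 :=
      HomologicalComplex.single_obj_d ..
    rw [e1, e2, d1, d2, comp_zero, zero_comp, zero_add, zero_add] at e
    exact e

instance : (singleKb A).Full where
  map_surjective {X Y} f := by
    obtain ⟨g, hg⟩ := (HomotopyCategory.singleFunctor A 0).map_surjective (X := X) (Y := Y)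
      ((bounded A).ι.map f)
    exact ⟨g, (bounded A).ι.map_injective hg⟩

instance : (singleKb A).Faithful where
  map_injective {X Y} f g h :=
    (HomotopyCategory.singleFunctor A 0).map_injective (congrArg (bounded A).ι.map h)

instance : (singleKb A).Additive where
  map_add {_ _ f g} := (bounded A).ι.map_injective
    ((HomotopyCategory.singleFunctor A 0).map_add (f := f) (g := g))

lemma hom_shift_eq_zero_of_isZero [HasBinaryBiproducts A] (K L : Kb A) (j : ℤ)
    (h : ∀ i, IsZero (K.obj.as.X i) ∨ IsZero (L.obj.as.X (i + j))) (f : K ⟶ L⟦j⟧) : f = 0 := by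
  apply (bounded A).ι.map_injective
  rw [Functor.map_zero]
  let K' : CochainComplex A ℤ := K.obj.as
  let L' : CochainComplex A ℤ := L.obj.as
  let e : (bounded A).ι.obj (L⟦j⟧) ≅ (HomotopyCategory.quotient A (.up ℤ)).obj (L'⟦j⟧) :=
    ((bounded A).ι.commShiftIso j).app L ≪≫
      (((HomotopyCategory.quotient A (.up ℤ)).commShiftIso j).app L').symm
  obtain ⟨g, hg⟩ := (HomotopyCategory.quotient A (.up ℤ)).map_surjective (X := K') (Y := L'⟦j⟧)
    ((bounded A).ι.map f ≫ e.hom)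
  have : g = 0 := by
    ext i
    rcases h i with h | h
    · exact h.eq_of_src _ _
    · exact h.eq_of_tgt _ _
  rw [this, Functor.map_zero] at hg
  rw [← cancel_mono e.hom, zero_comp]
  exact hg.symm

lemma isZero_singleKb (X : A) (i : ℤ) (hi : i ≠ 0) : IsZero (((singleKb A).obj X).obj.as.X i) :=
  HomologicalComplex.isZero_single_obj_X (.up ℤ) 0 X i hi

lemma single_hom_shift_eq_zero [HasBinaryBiproducts A] (X Y : A) (j : ℤ) (hj : j ≠ 0)
    (f : (singleKb A).obj X ⟶ ((singleKb A).obj Y)⟦j⟧) : f = 0 :=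
  hom_shift_eq_zero_of_isZero _ _ _ (fun i => by
    by_cases hi : i = 0
    · exact Or.inr (isZero_singleKb _ _ (by omega))
    · exact Or.inl (isZero_singleKb _ _ hi)) f

lemma single_hom_shift_neg_eq_zero [HasBinaryBiproducts A] (K : Kb A) :
    ∃ m : ℕ, ∀ (X : A) (f : (singleKb A).obj X ⟶ K⟦-(m : ℤ)⟧), f = 0 := by
  obtain ⟨K, a, b, ha, hb⟩ := K
  refine ⟨(1 - a).toNat, fun X f => hom_shift_eq_zero_of_isZero _ _ _ (fun i => ?_) f⟩
  by_cases hi : i = 0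
  · exact Or.inr (CochainComplex.isZero_of_isStrictlyGE (K.as : CochainComplex A ℤ) a _ (by omega))
  · exact Or.inl (isZero_singleKb _ _ hi)

end Degree

section ProjInjSingle

variable {C : Type u} [Category.{v} C] [Abelian C] {n : ℕ} {W : 𝟭 C ⟶ 𝟭 C}

lemma single_hom_acyclic (P : MF n W) (hP : PI n W P) (K : Kb (MF n W)) (hK : exAcyclic n W K)
    (f : (singleKb (MF n W)).obj P ⟶ K) : f = 0 := by
  apply (bounded (MF n W)).ι.map_injective
  rw [Functor.map_zero]
  obtain ⟨⟨K : CochainComplex (MF n W) ℤ⟩, bK⟩ := K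
  obtain ⟨Z, ι, π, w, hd, hS⟩ := hK
  change ∀ j, Z j ⟶ K.X j at ι
  change ∀ j, K.X j ⟶ Z (j + 1) at π
  change ∀ j, π j ≫ ι (j + 1) = K.d j (j + 1) at hd
  let P' : CochainComplex (MF n W) ℤ := (HomologicalComplex.single _ (.up ℤ) 0).obj P
  obtain ⟨g, hg⟩ := (HomotopyCategory.quotient (MF n W) (.up ℤ)).map_surjective (X := P') (Y := K)
    ((bounded (MF n W)).ι.map f)
  refine hg.symm.trans ((HomotopyCategory.quotient_map_eq_zero_iff g).2 ?_)
  have hz : ∀ i j (h : P'.X i ⟶ K.X j), i ≠ 0 → h = 0 := fun i j h hi =>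
    (HomologicalComplex.isZero_single_obj_X (.up ℤ) 0 P i hi).eq_of_src _ _
  have hd' : ∀ (x : ℤ), x = 0 → ∀ y, y + 1 = x → ∃ h : P'.X x ⟶ K.X y, h ≫ K.d y x = g.f x := by
    rintro x hx y rfl
    have e : P ≅ P'.X (y + 1) := hx ▸ (HomologicalComplex.singleObjXSelf (.up ℤ) 0 P).symm
    have hgd : g.f (y + 1) ≫ K.d (y + 1) (y + 1 + 1) = 0 := by
      rw [g.comm, HomologicalComplex.single_obj_d, zero_comp]
    have h1 : g.f (y + 1) ≫ π (y + 1) = 0 := by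
      apply exSeq.mono (hS (y + 1 + 1))
      change (g.f (y + 1) ≫ π (y + 1)) ≫ ι (y + 1 + 1) = 0 ≫ _
      rw [Category.assoc, hd, hgd, zero_comp]
    obtain ⟨k, hk⟩ := exSeq.exists_lift (hS (y + 1)) (g.f (y + 1)) h1
    change P'.X (y + 1) ⟶ Z (y + 1) at k
    change k ≫ ι (y + 1) = _ at hk
    obtain ⟨l, hl⟩ := hP.1 _ (hS y) (e.hom ≫ k)
    change P ⟶ K.X y at l
    change l ≫ π y = _ at hl
    refine ⟨e.inv ≫ l, ?_⟩
    rw [← hd, Category.assoc, reassoc_of% hl, hk, e.inv_hom_id_assoc]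
  classical
  obtain ⟨h, hh⟩ := hd' 0 rfl (-1) (by simp)
  let H : ∀ i j : ℤ, P'.X i ⟶ K.X j := fun i j =>
    if e : i = 0 ∧ j = -1 then eqToHom (by rw [e.1]) ≫ h ≫ eqToHom (by rw [e.2]) else 0
  have H0 : H 0 (-1) = h := by simp [H]
  refine ⟨⟨H, fun i j hij => dif_neg fun e => hij ?_, fun i => ?_⟩⟩
  · rw [e.1, e.2]; simp
  · have e1 := dNext_eq H (show (ComplexShape.up ℤ).Rel i (i + 1) by simp)
    have e2 := prevD_eq H (show (ComplexShape.up ℤ).Rel (i - 1) i by simp)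
    rw [e1, e2]
    by_cases hi : i = 0
    · subst hi
      have : P'.d 0 (0 + 1) = 0 := HomologicalComplex.single_obj_d ..
      rw [this]
      simpa [H0] using hh.symm
    · exact (hz _ _ _ hi).trans (hz _ _ _ hi).symm

lemma acyclic_hom_single (P : MF n W) (hP : PI n W P) (K : Kb (MF n W)) (hK : exAcyclic n W K)
    (f : K ⟶ (singleKb (MF n W)).obj P) : f = 0 := by
  apply (bounded (MF n W)).ι.map_injective
  rw [Functor.map_zero]
  obtain ⟨⟨K : CochainComplex (MF n W) ℤ⟩, bK⟩ := K
  obtain ⟨Z, ι, π, w, hd, hS⟩ := hK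
  change ∀ j, Z j ⟶ K.X j at ι
  change ∀ j, K.X j ⟶ Z (j + 1) at π
  change ∀ j, π j ≫ ι (j + 1) = K.d j (j + 1) at hd
  let P' : CochainComplex (MF n W) ℤ := (HomologicalComplex.single _ (.up ℤ) 0).obj P
  obtain ⟨g, hg⟩ := (HomotopyCategory.quotient (MF n W) (.up ℤ)).map_surjective (X := K) (Y := P')
    ((bounded (MF n W)).ι.map f)
  refine hg.symm.trans ((HomotopyCategory.quotient_map_eq_zero_iff g).2 ?_)
  have hz : ∀ i j (h : K.X i ⟶ P'.X j), j ≠ 0 → h = 0 := fun i j h hj =>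
    (HomologicalComplex.isZero_single_obj_X (.up ℤ) 0 P j hj).eq_of_tgt _ _
  have hd' : ∀ (y : ℤ), y + 1 = 0 → ∃ h : K.X (y + 1 + 1) ⟶ P'.X (y + 1),
      K.d (y + 1) (y + 1 + 1) ≫ h = g.f (y + 1) := by
    rintro y hx
    have e : P ≅ P'.X (y + 1) := hx ▸ (HomologicalComplex.singleObjXSelf (.up ℤ) 0 P).symm
    have hgd : K.d y (y + 1) ≫ g.f (y + 1) = 0 := by
      rw [← g.comm, HomologicalComplex.single_obj_d, comp_zero]
    have h1 : ι (y + 1) ≫ g.f (y + 1) = 0 := by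
      apply exSeq.epi (hS y)
      change π y ≫ ι (y + 1) ≫ g.f (y + 1) = _ ≫ 0
      rw [← Category.assoc, hd, hgd, comp_zero]
    obtain ⟨k, hk⟩ := exSeq.exists_desc (hS (y + 1)) (g.f (y + 1)) h1
    change Z (y + 1 + 1) ⟶ P'.X (y + 1) at k
    change π (y + 1) ≫ k = _ at hk
    obtain ⟨l, hl⟩ := hP.2 _ (hS (y + 1 + 1)) (k ≫ e.inv)
    change K.X (y + 1 + 1) ⟶ P at l
    change ι (y + 1 + 1) ≫ l = _ at hl
    refine ⟨l ≫ e.hom, ?_⟩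
    rw [← hd, Category.assoc, reassoc_of% hl, e.inv_hom_id, Category.comp_id, hk]
  have hd2 : ∀ y z t : ℤ, y + 1 = z → z = 0 → z + 1 = t →
      ∃ h : K.X t ⟶ P'.X z, K.d z t ≫ h = g.f z := by
    rintro y z t rfl h rfl
    exact hd' y h
  classical
  obtain ⟨h, hh⟩ := hd2 (-1) 0 1 rfl rfl rfl
  let H : ∀ i j : ℤ, K.X i ⟶ P'.X j := fun i j =>
    if e : i = 1 ∧ j = 0 then eqToHom (by rw [e.1]) ≫ h ≫ eqToHom (by rw [e.2]) else 0
  have H0 : H 1 0 = h := by simp [H]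
  refine ⟨⟨H, fun i j hij => dif_neg fun e => hij ?_, fun i => ?_⟩⟩
  · rw [e.1, e.2]; simp
  · have e1 := dNext_eq H (show (ComplexShape.up ℤ).Rel i (i + 1) by simp)
    have e2 := prevD_eq H (show (ComplexShape.up ℤ).Rel (i - 1) i by simp)
    rw [e1, e2]
    by_cases hi : i = 0
    · subst hi
      have : P'.d (0 - 1) 0 = 0 := HomologicalComplex.single_obj_d ..
      rw [this]
      simpa [H0] using hh.symm
    · exact (hz _ _ _ hi).trans (hz _ _ _ hi).symm

end ProjInjSingle

lemma isIso_of_split_triangle {D : Type*} [Category D] [Preadditive D] [HasZeroObject D]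
    [HasShift D ℤ] [∀ a : ℤ, (shiftFunctor D a).Additive] [Pretriangulated D]
    {X Y Z K : D} (f : X ⟶ Y) (g : Y ⟶ Z) (r : Y ⟶ X) (s : Z ⟶ Y) (h1 : f ≫ r = 𝟙 _)
    (h2 : s ≫ g = 𝟙 _) (h3 : r ≫ f + g ≫ s = 𝟙 _) (u : Y ⟶ K) (v : K ⟶ X⟦(1 : ℤ)⟧)
    (hT : Triangle.mk f u v ∈ distTriang D) (c : K ⟶ Z) (hc : u ≫ c = g) : IsIso c := by
  have hv : v = 0 := by
    have h4 : v ≫ f⟦(1 : ℤ)⟧' = 0 := comp_distTriang_mor_zero₃₁ _ hT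
    have h5 : f⟦(1 : ℤ)⟧' ≫ r⟦(1 : ℤ)⟧' = 𝟙 _ := by rw [← Functor.map_comp, h1]; exact (shiftFunctor D (1 : ℤ)).map_id _
    rw [← Category.comp_id v, ← h5, reassoc_of% h4, zero_comp]
  have hu : ∀ ψ : K ⟶ K, u ≫ ψ = 0 → ψ = 0 := fun ψ h => by
    obtain ⟨k, rfl⟩ := yo₃ hT ψ h
    rw [hv, zero_comp]
  have h0 : f ≫ u = 0 := comp_distTriang_mor_zero₁₂ _ hT
  refine ⟨s ≫ u, ?_, by rw [Category.assoc, hc, h2]⟩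
  rw [← sub_eq_zero]
  apply hu
  have h6 := congrArg (· ≫ u) h3
  simp only [Preadditive.add_comp, Category.assoc, h0, comp_zero, zero_add, Category.id_comp] at h6
  rw [Preadditive.comp_sub, reassoc_of% hc, h6, Category.comp_id, sub_self]

lemma isIso_of_split_triangle_of_iso {D : Type*} [Category D] [Preadditive D] [HasZeroObject D]
    [HasShift D ℤ] [∀ a : ℤ, (shiftFunctor D a).Additive] [Pretriangulated D]
    {X Y Z K X' Y' Z' : D} (e₁ : X ≅ X') (e₂ : Y ≅ Y') (e₃ : Z ≅ Z')
    (f : X' ⟶ Y') (g : Y' ⟶ Z') (r : Y' ⟶ X') (s : Z' ⟶ Y') (h1 : f ≫ r = 𝟙 _)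
    (h2 : s ≫ g = 𝟙 _) (h3 : r ≫ f + g ≫ s = 𝟙 _)
    (f' : X ⟶ Y) (g' : Y ⟶ Z) (hf : f' ≫ e₂.hom = e₁.hom ≫ f) (hg : g' ≫ e₃.hom = e₂.hom ≫ g)
    (u : Y ⟶ K) (v : K ⟶ X⟦(1 : ℤ)⟧)
    (hT : Triangle.mk f' u v ∈ distTriang D) (c : K ⟶ Z) (hc : u ≫ c = g') : IsIso c := by
  refine isIso_of_split_triangle f' g' (e₂.hom ≫ r ≫ e₁.inv) (e₃.hom ≫ s ≫ e₂.inv) ?_ ?_ ?_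
    u v hT c hc
  · rw [reassoc_of% hf, reassoc_of% h1, e₁.hom_inv_id]
  · rw [Category.assoc, Category.assoc, ← cancel_mono e₃.hom]
    simp [hg, h2]
  · rw [← cancel_mono e₂.hom]
    have := congrArg (e₂.hom ≫ ·) h3
    simpa [hf, reassoc_of% hg] using this

section Extension

variable {C : Type u} [Category.{v} C] [Abelian C] {n : ℕ} {W : 𝟭 C ⟶ 𝟭 C}

/-- The components of a matrix factorization, as a complex concentrated in degree zero. -/
noncomputable def singleCompIso (i : ZMod n) :
    singleKb (MF n W) ⋙ compFunctor n i ≅ MF.ev n W i ⋙ HomotopyCategory.singleFunctor C 0 :=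
  Functor.isoWhiskerRight (HomologicalComplex.singleMapHomologicalComplex (MF.ev n W i) (.up ℤ) 0)
    (HomotopyCategory.quotient C (.up ℤ))

lemma trW_of_exSeq (Q : ShortComplex (MF n W)) (hQ : exSeq n W Q) {K : Kb (MF n W)}
    (u : (singleKb (MF n W)).obj Q.X₂ ⟶ K) (v : K ⟶ ((singleKb (MF n W)).obj Q.X₁)⟦(1 : ℤ)⟧)
    (hT : Triangle.mk ((singleKb (MF n W)).map Q.f) u v ∈ distTriang _)
    (c : K ⟶ (singleKb (MF n W)).obj Q.X₃) (hc : u ≫ c = (singleKb (MF n W)).map Q.g) :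
    (exAcyclic n W).trW c := by
  obtain ⟨Z, a, b, hZ⟩ := distinguished_cocone_triangle c
  refine ⟨Z, a, b, hZ, (exAcyclic_iff n W Z).2 fun i => ?_⟩
  let F := compFunctor (W := W) n i
  have hF : IsIso (F.map c) := by
    obtain ⟨r, s, h1, h2, h3⟩ := hQ.data i
    let e := singleCompIso (n := n) (W := W) i
    let H := HomotopyCategory.singleFunctor C 0
    have k1 : H.map (Q.f.f i) ≫ H.map r = 𝟙 _ := by rw [← H.map_comp, h1]; exact H.map_id _
    have k2 : H.map s ≫ H.map (Q.g.f i) = 𝟙 _ := by rw [← H.map_comp, h2]; exact H.map_id _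
    have k3 : H.map r ≫ H.map (Q.f.f i) + H.map (Q.g.f i) ≫ H.map s = 𝟙 _ := by
      rw [← H.map_comp, ← H.map_comp, ← H.map_add, h3]; exact H.map_id _
    exact isIso_of_split_triangle_of_iso (e.app Q.X₁) (e.app Q.X₂) (e.app Q.X₃)
      (H.map (Q.f.f i)) (H.map (Q.g.f i)) (H.map r) (H.map s) k1 k2 k3
      (F.map ((singleKb (MF n W)).map Q.f)) (F.map ((singleKb (MF n W)).map Q.g))
      (e.hom.naturality Q.f) (e.hom.naturality Q.g) (F.map u)
      (F.map v ≫ (F.commShiftIso (1 : ℤ)).hom.app _) (F.map_distinguished _ hT) (F.map c)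
      (by rw [← F.map_comp, hc])
  exact Triangle.isZero₃_of_isIso₁ _ (F.map_distinguished _ hZ) hF

end Extension

section Verdier

variable {D : Type u} [Category.{v} D] [Preadditive D] [HasZeroObject D] [HasShift D ℤ]
  [∀ a : ℤ, (shiftFunctor D a).Additive] [Pretriangulated D] [IsTriangulated D]

/-- The Verdier quotient of a triangulated category by the smallest thick triangulated
subcategory containing a given nonempty class of objects. -/
def VerdierQuotient (P : ObjectProperty D) [P.Nonempty] : Type u :=
  P.triangEnvelope.trW.Localization

variable (P : ObjectProperty D) [P.Nonempty]

noncomputable instance : Category (VerdierQuotient P) :=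
  inferInstanceAs (Category P.triangEnvelope.trW.Localization)

noncomputable instance : Preadditive (VerdierQuotient P) :=
  inferInstanceAs (Preadditive P.triangEnvelope.trW.Localization)

instance : HasZeroObject (VerdierQuotient P) :=
  inferInstanceAs (HasZeroObject P.triangEnvelope.trW.Localization)

noncomputable instance : HasShift (VerdierQuotient P) ℤ :=
  inferInstanceAs (HasShift P.triangEnvelope.trW.Localization ℤ)

instance (a : ℤ) : (shiftFunctor (VerdierQuotient P) a).Additive :=
  inferInstanceAs (shiftFunctor P.triangEnvelope.trW.Localization a).Additive

noncomputable instance : Pretriangulated (VerdierQuotient P) :=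
  inferInstanceAs (Pretriangulated P.triangEnvelope.trW.Localization)

instance : IsTriangulated (VerdierQuotient P) :=
  inferInstanceAs (IsTriangulated P.triangEnvelope.trW.Localization)

/-- The quotient functor. -/
noncomputable def quotientFunctor : D ⥤ VerdierQuotient P := P.triangEnvelope.trW.Q

instance : (quotientFunctor P).IsLocalization P.triangEnvelope.trW :=
  inferInstanceAs (P.triangEnvelope.trW.Q.IsLocalization P.triangEnvelope.trW)

noncomputable instance : (quotientFunctor P).CommShift ℤ :=
  inferInstanceAs (P.triangEnvelope.trW.Q.CommShift ℤ)

instance : (quotientFunctor P).IsTriangulated :=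
  inferInstanceAs P.triangEnvelope.trW.Q.IsTriangulated

end Verdier

section Functors

variable {C : Type u} [Category.{v} C] [Abelian C] (n : ℕ) (W : 𝟭 C ⟶ 𝟭 C)

/-- The bounded derived category of matrix factorizations with the graded-split exact
structure. -/
abbrev Dex := VerdierQuotient (exAcyclic n W)

/-- The bounded derived category of matrix factorizations with the abelian exact structure. -/
abbrev Dab := VerdierQuotient (abAcyclic n W)

/-- The functor from the derived category of the graded-split exact structure to the derived
category of the abelian exact structure. -/
noncomputable def q₁ : Dex n W ⥤ Dab n W :=
  Localization.lift (quotientFunctor (abAcyclic n W))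
    (fun _ _ f hf => Localization.inverts (quotientFunctor (abAcyclic n W))
      (abAcyclic n W).triangEnvelope.trW f
      (ObjectProperty.trW_monotone (ObjectProperty.monotone_triangEnvelope
        (exAcyclic_le_abAcyclic n W)) _ hf))
    (quotientFunctor (exAcyclic n W))

/-- The bounded complexes of projective-injective objects of the graded-split exact
structure. -/
def KbProjInj : ObjectProperty (Kb (MF n W)) :=
  fun K => ∀ j, ProjInj (exSeq n W) (K.obj.as.X j)

instance : (KbProjInj n W).Nonempty :=
  ⟨⟨⟨(HomotopyCategory.quotient _ _).obj 0,
    0, 0, inferInstanceAs (CochainComplex.IsStrictlyGE (0 : CochainComplex (MF n W) ℤ) 0),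
      inferInstanceAs (CochainComplex.IsStrictlyLE (0 : CochainComplex (MF n W) ℤ) 0)⟩,
    fun _ => projInj_of_isZero _ ((HomologicalComplex.eval _ _ _).map_isZero (isZero_zero _))⟩⟩

/-- The bounded complexes of projective-injective objects in the derived category of the
graded-split exact structure. -/
abbrev KbProjInjEx : ObjectProperty (Dex n W) :=
  (KbProjInj n W).map (quotientFunctor (exAcyclic n W))

/-- The bounded complexes of projective-injective objects in the derived category of the
abelian exact structure. -/
abbrev KbProjInjAb : ObjectProperty (Dab n W) :=
  (KbProjInj n W).map (quotientFunctor (abAcyclic n W))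

/-- The abelian-acyclic complexes in the derived category of the graded-split exact structure. -/
abbrev acyclicEx : ObjectProperty (Dex n W) :=
  (abAcyclic n W).map (quotientFunctor (exAcyclic n W))

/-- A matrix factorization as an object of the derived category of the graded-split exact
structure. -/
noncomputable abbrev derivedSingle : MF n W ⥤ Dex n W :=
  singleKb (MF n W) ⋙ quotientFunctor (exAcyclic n W)


instance : (exAcyclic n W).IsStableUnderRetracts where
  of_retract r h := by
    rw [exAcyclic_iff] at h ⊢
    intro i
    have e := (r.map (compFunctor n i)).retract
    rw [IsZero.iff_id_eq_zero, ← e, (h i).eq_of_tgt ((r.map (compFunctor n i)).i) 0, zero_comp]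

lemma triangEnvelope_exAcyclic : (exAcyclic n W).triangEnvelope = exAcyclic n W :=
  le_antisymm ((ObjectProperty.triangEnvelope_le_iff _).2 le_rfl) (exAcyclic n W).le_triangEnvelope

instance : (quotientFunctor (exAcyclic n W)).IsLocalization (exAcyclic n W).trW := by
  have h : (quotientFunctor (exAcyclic n W)).IsLocalization
    (exAcyclic n W).triangEnvelope.trW := inferInstance
  rwa [triangEnvelope_exAcyclic] at h

variable {n W}

lemma projInj_of_iso {E : Type*} [Category E] [HasZeroMorphisms E]
    (S : ObjectProperty (ShortComplex E)) {P Q : E} (e : P ≅ Q) (h : ProjInj S P) : ProjInj S Q := by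
  constructor
  · intro T hT f
    obtain ⟨g, hg⟩ := h.1 T hT (e.hom ≫ f)
    exact ⟨e.inv ≫ g, by simp [hg]⟩
  · intro T hT f
    obtain ⟨g, hg⟩ := h.2 T hT (f ≫ e.inv)
    exact ⟨g ≫ e.hom, by simp [reassoc_of% hg]⟩

lemma KbProjInj_single (P : MF n W) (hP : PI n W P) :
    KbProjInj n W ((singleKb (MF n W)).obj P) := by
  intro j
  by_cases hj : j = 0
  · subst hj
    exact projInj_of_iso _ (HomologicalComplex.singleObjXSelf (.up ℤ) 0 P).symm hP
  · exact projInj_of_isZero _ (isZero_singleKb _ _ hj)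

/-- The objects with no morphism of high degree to matrix factorizations. -/
def vanishing (n : ℕ) (W : 𝟭 C ⟶ 𝟭 C) : ObjectProperty (Dex n W) := fun Z =>
  ∃ m₀ : ℤ, ∀ m, m₀ ≤ m → ∀ (Y : MF n W) (f : Z ⟶ ((derivedSingle n W).obj Y)⟦m⟧), f = 0

lemma hom_of_shift_eq_zero {T : Type*} [Category T] [Preadditive T] [HasShift T ℤ]
    [∀ a : ℤ, (shiftFunctor T a).Additive] {X B : T} (a b : ℤ)
    (h : ∀ g : X ⟶ B⟦b - a⟧, g = 0) (f : X⟦a⟧ ⟶ B⟦b⟧) : f = 0 := by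
  have h1 := h ((shiftShiftNeg X a).inv ≫ f⟦-a⟧' ≫
    (shiftFunctorAdd' T b (-a) (b - a) (by ring)).inv.app B)
  have h2 : f⟦-a⟧' = 0 := by
    rw [← cancel_mono ((shiftFunctorAdd' T b (-a) (b - a) (by ring)).inv.app B),
      ← cancel_epi (shiftShiftNeg X a).inv, h1, zero_comp, comp_zero]
  exact (shiftFunctor T (-a)).map_injective (by rw [h2, Functor.map_zero])

instance : (vanishing n W).IsStableUnderRetracts where
  of_retract r h := by
    obtain ⟨m₀, h⟩ := h
    refine ⟨m₀, fun m hm Y f => ?_⟩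
    rw [← Category.id_comp f, ← r.retract, Category.assoc, h m hm Y (r.r ≫ f), comp_zero]

instance : (vanishing n W).ContainsZero where
  exists_zero := ⟨0, isZero_zero _, 0, fun _ _ _ _ => (isZero_zero _).eq_of_src _ _⟩

instance : (vanishing n W).IsStableUnderShift ℤ where
  isStableUnderShiftBy a :=
    { le_shift := fun Z ⟨m₀, h⟩ => ⟨m₀ + a, fun m hm Y f =>
        hom_of_shift_eq_zero a m (h (m - a) (by omega) Y) f⟩ }

instance : (vanishing n W).IsTriangulated where
  toIsTriangulatedClosed₂ := .mk' fun T hT ⟨a, ha⟩ ⟨b, hb⟩ =>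
    ⟨max a b, fun m hm Y f => by
      obtain ⟨g, rfl⟩ := Triangle.yoneda_exact₂ T hT f (ha m (le_of_max_le_left hm) Y _)
      rw [hb m (le_of_max_le_right hm) Y g, comp_zero]⟩

lemma hproj [NeZero n] : EnoughProj (exSeq n W) := fun M => by
  obtain ⟨S, h, hp, rfl⟩ := exists_proj M
  exact ⟨_, _, S.f, S.g, S.zero, h, hp⟩

lemma hinj [NeZero n] : EnoughInj (exSeq n W) := fun M => by
  obtain ⟨S, h, hp, rfl⟩ := exists_inj M
  exact ⟨_, _, S.f, S.g, S.zero, h, hp⟩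

lemma hcone [NeZero n] : EnoughCones (exSeq n W) := fun {X Y} f => by
  obtain ⟨I, K, i, p, w, h, hI⟩ := hinj X
  refine ⟨I, _, biprod.lift f i, _, (cokerSeq (biprod.lift f i)).zero,
    exSeq_cokerSeq (biprod.lift f i) fun a => ?_, hI, biprod.lift_fst _ _⟩
  obtain ⟨r, s, h1, -, -⟩ := h.data a
  let r' : I.X a ⟶ X.X a := r
  have h1' : i.f a ≫ r' = 𝟙 _ := h1
  refine ⟨(biprod.snd : Y ⊞ I ⟶ I).f a ≫ r', ?_⟩
  have h2 : (biprod.lift f i).f a ≫ (biprod.snd : Y ⊞ I ⟶ I).f a = i.f a :=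
    congrArg (fun φ => MF.Hom.f φ a) (biprod.lift_snd f i)
  rw [reassoc_of% h2, h1']

lemma KbProjInj_vanishing : (KbProjInjEx n W).triangEnvelope ≤ vanishing n W := by
  rw [ObjectProperty.triangEnvelope_le_iff]
  rintro Z ⟨K, hK, ⟨e⟩⟩
  refine (vanishing n W).prop_of_iso e ?_
  exact devissage ((vanishing n W).inverseImage (quotientFunctor (exAcyclic n W))) (PI n W)
    (projInj_zero _) (fun P hP => ⟨1, fun m hm Y f => hom_projInj_left (exSeq n W)
      (singleKb (MF n W)) (exAcyclic n W) (quotientFunctor (exAcyclic n W))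
      single_hom_shift_eq_zero (fun P hP K hK f => single_hom_acyclic P hP K hK f) P Y hP m (by omega) f⟩) K hK

instance derivedSingle_full [NeZero n] : (derivedSingle n W).Full :=
  derived_full (exSeq n W) (singleKb (MF n W)) (exAcyclic n W) _ hproj
    (fun Q hQ _ f h => exSeq.epi hQ (h.trans comp_zero.symm))
    (fun Q hQ _ f h => exSeq.exists_desc hQ f h)
    single_hom_shift_eq_zero
    (fun P hP K hK f => single_hom_acyclic P hP K hK f)
    (fun Q hQ _ u v hT c hc => trW_of_exSeq Q hQ u v hT c hc)
    (fun K _ => single_hom_shift_neg_eq_zero K)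

instance derivedSingle_faithful [NeZero n] : (derivedSingle n W).Faithful :=
  derived_faithful (exSeq n W) (singleKb (MF n W)) (exAcyclic n W) _ hproj
    (fun Q hQ _ f h => exSeq.epi hQ (h.trans comp_zero.symm))
    (fun Q hQ _ f h => exSeq.exists_desc hQ f h)
    single_hom_shift_eq_zero
    (fun P hP K hK f => single_hom_acyclic P hP K hK f)
    (fun Q hQ _ u v hT c hc => trW_of_exSeq Q hQ u v hT c hc)
    (fun K _ => single_hom_shift_neg_eq_zero K)

lemma derivedSingle_triangle (Q : ShortComplex (MF n W)) (hQ : exSeq n W Q) :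
    ∃ δ : (derivedSingle n W).obj Q.X₃ ⟶ ((derivedSingle n W).obj Q.X₁)⟦(1 : ℤ)⟧,
      Triangle.mk ((derivedSingle n W).map Q.f) ((derivedSingle n W).map Q.g) δ ∈ distTriang _ :=
  triangle_of_ext (exSeq n W) (singleKb (MF n W)) (exAcyclic n W) _
    (fun Q hQ _ u v hT c hc => trW_of_exSeq Q hQ u v hT c hc) Q hQ

instance : (derivedSingle n W).Additive :=
  have : (quotientFunctor (exAcyclic n W)).Additive := inferInstance
  Functor.instAdditiveComp ..

lemma derivedSingle_projInj (P : MF n W) (hP : ProjInj (exSeq n W) P) :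
    (KbProjInjEx n W).triangEnvelope ((derivedSingle n W).obj P) :=
  (KbProjInjEx n W).le_triangEnvelope _
    (ObjectProperty.prop_map_obj _ _ (KbProjInj_single P hP))

/-- The functor from the stable category to the quotient of the derived category by the bounded
complexes of projective-injective objects, sending `X` to `X` concentrated in degree zero. -/
noncomputable def stabToQuotient (n : ℕ) (W : 𝟭 C ⟶ 𝟭 C) :
    Stab (exSeq n W) ⥤ VerdierQuotient (KbProjInjEx n W) :=
  CategoryTheory.Quotient.lift (stabRel (exSeq n W))
    (derivedSingle n W ⋙ quotientFunctor (KbProjInjEx n W))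
    fun _ _ _ _ h => map_eq_of_stabRel (exSeq n W) (derivedSingle n W)
      (KbProjInjEx n W).triangEnvelope _ derivedSingle_projInj h

instance [NeZero n] : (stabToQuotient n W).IsEquivalence :=
  isEquivalence_lift (exSeq n W) (derivedSingle n W)
    (KbProjInjEx n W).triangEnvelope _ hproj hinj hcone derivedSingle_triangle
    (fun X P hP j hj f => hom_projInj_right (exSeq n W) (singleKb (MF n W))
      (exAcyclic n W) _ single_hom_shift_eq_zero
      (fun P hP K hK f => acyclic_hom_single P hP K hK f) X P hP j hj.ne' f)
    (fun Q _ _ h Z => by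
      have := Localization.essSurj (quotientFunctor (exAcyclic n W)) (exAcyclic n W).trW
      refine Q.prop_of_iso ((quotientFunctor (exAcyclic n W)).objObjPreimageIso Z) ?_
      exact devissage (Q.inverseImage (quotientFunctor (exAcyclic n W))) ⊤ trivial
        (fun X _ => h X) _ fun _ => trivial)
    derivedSingle_projInj
    (fun Z hZ => by
      obtain ⟨m₀, h⟩ := KbProjInj_vanishing Z hZ
      exact ⟨m₀.toNat, fun m hm Y f => h m (by omega) Y f⟩)

end Functors

section Total

variable {C : Type u} [Category.{v} C] [Abelian C] (n : ℕ) (W : 𝟭 C ⟶ 𝟭 C)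

/-- The stable category of matrix factorizations, for the graded-split exact structure. -/
def StabMF : Type (max u v) := Stab (exSeq n W)

instance : Category (StabMF n W) := inferInstanceAs (Category (Stab (exSeq n W)))

noncomputable instance : Preadditive (StabMF n W) :=
  inferInstanceAs (Preadditive (Stab (exSeq n W)))

/-- The quotient functor from matrix factorizations to their stable category. -/
def toStab : MF n W ⥤ StabMF n W := Quotient.functor (stabRel (exSeq n W))

instance : (toStab n W).Additive :=
  inferInstanceAs (Quotient.functor (stabRel (exSeq n W))).Additive

instance : HasZeroObject (StabMF n W) :=
  ⟨_, (toStab n W).map_isZero (isZero_zero _)⟩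

variable [NeZero n]

/-- The totalization functor: the quotient functor to the derived category modulo bounded complexes
of projective-injective objects, followed by the inverse of the equivalence of the stable category
with that quotient. -/
noncomputable def Tot : Dex n W ⥤ StabMF n W :=
  quotientFunctor (KbProjInjEx n W) ⋙ (stabToQuotient n W).inv

instance : (Tot n W).IsLocalization (KbProjInjEx n W).triangEnvelope.trW :=
  Functor.IsLocalization.of_equivalence_target (quotientFunctor (KbProjInjEx n W)) _ _
    (stabToQuotient n W).asEquivalence.symm (Iso.refl _)

instance : (stabToQuotient n W).Additive where
  map_add {X Y} f g := by
    obtain ⟨X⟩ := X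
    obtain ⟨Y⟩ := Y
    obtain ⟨f, rfl⟩ := (Quotient.functor (stabRel (exSeq n W))).map_surjective (X := X) (Y := Y) f
    obtain ⟨g, rfl⟩ := (Quotient.functor (stabRel (exSeq n W))).map_surjective (X := X) (Y := Y) g
    rw [← (Quotient.functor (stabRel (exSeq n W))).map_add]
    have h : (quotientFunctor (KbProjInjEx n W)).Additive := inferInstance
    have h' : (derivedSingle n W ⋙ quotientFunctor (KbProjInjEx n W)).Additive :=
      Functor.instAdditiveComp ..
    exact (derivedSingle n W ⋙ quotientFunctor (KbProjInjEx n W)).map_add (f := f) (g := g)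

instance : (Tot n W).Additive := by
  have : (quotientFunctor (KbProjInjEx n W)).Additive := inferInstance
  have h : (stabToQuotient n W).asEquivalence.functor.Additive :=
    inferInstanceAs (stabToQuotient n W).Additive
  have h' : (stabToQuotient n W).inv.Additive :=
    @Equivalence.inverse_additive _ _ _ _ _ _ (stabToQuotient n W).asEquivalence h
  exact ⟨fun {_ _ _ _} => (congrArg (stabToQuotient n W).inv.map
    (quotientFunctor (KbProjInjEx n W)).map_add).trans h'.map_add⟩

/-- The shift on the stable category, transported along the equivalence with the quotient of the
derived category by bounded complexes of projective-injective objects. -/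
noncomputable instance : HasShift (StabMF n W) ℤ :=
  HasShift.localized (Tot n W) (KbProjInjEx n W).triangEnvelope.trW ℤ

noncomputable instance : (Tot n W).CommShift ℤ :=
  Functor.CommShift.localized (Tot n W) (KbProjInjEx n W).triangEnvelope.trW ℤ

instance (a : ℤ) : (shiftFunctor (StabMF n W) a).Additive := by
  rw [Localization.functor_additive_iff (Tot n W) (KbProjInjEx n W).triangEnvelope.trW]
  exact Functor.additive_of_iso ((Tot n W).commShiftIso a)

/-- The triangulated structure on the stable category. -/
noncomputable instance : Pretriangulated (StabMF n W) :=
  Triangulated.Localization.pretriangulated (Tot n W) (KbProjInjEx n W).triangEnvelope.trW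

instance : (Tot n W).IsTriangulated := inferInstance

instance : IsTriangulated (StabMF n W) :=
  Triangulated.Localization.isTriangulated (Tot n W) (KbProjInjEx n W).triangEnvelope.trW

/-- A matrix factorization concentrated in degree zero has itself as totalization. -/
noncomputable def derivedSingleTot : derivedSingle n W ⋙ Tot n W ≅ toStab n W :=
  Functor.isoWhiskerLeft (toStab n W) (stabToQuotient n W).asEquivalence.unitIso.symm

/-- Admissible short exact sequences give distinguished triangles in the stable category, as they
do for the usual triangulated structure on the stable category of a Frobenius category. -/
lemma stab_distinguished (S : ShortComplex (MF n W)) (hS : exSeq n W S) :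
    ∃ δ : (toStab n W).obj S.X₃ ⟶ ((toStab n W).obj S.X₁)⟦(1 : ℤ)⟧,
      Triangle.mk ((toStab n W).map S.f) ((toStab n W).map S.g) δ ∈ distTriang _ := by
  obtain ⟨δ, hδ⟩ := derivedSingle_triangle S hS
  let e := derivedSingleTot n W
  refine ⟨e.inv.app S.X₃ ≫ ((Tot n W).map δ ≫ ((Tot n W).commShiftIso (1 : ℤ)).hom.app _) ≫
    (e.hom.app S.X₁)⟦(1 : ℤ)⟧', isomorphic_distinguished _ ((Tot n W).map_distinguished _ hδ) _ ?_⟩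
  refine (Triangle.isoMk _ _ (e.app S.X₁) (e.app S.X₂) (e.app S.X₃) ?_ ?_ ?_).symm
  · exact e.hom.naturality S.f
  · exact e.hom.naturality S.g
  · exact (Iso.hom_inv_id_app_assoc e S.X₃ _).symm

/-- The totalizations of abelian-acyclic complexes, as objects of the stable category. -/
abbrev totAcyclic : ObjectProperty (StabMF n W) := (acyclicEx n W).map (Tot n W)

/-- The absolute derived category: the quotient of the stable category by the totalizations of
abelian-acyclic complexes. -/
abbrev Dabs := VerdierQuotient (totAcyclic n W)

/-- The quotient functor from the stable category to the absolute derived category. -/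
noncomputable abbrev q₂ : StabMF n W ⥤ Dabs n W := quotientFunctor (totAcyclic n W)

end Total

end NStep

open ObjectProperty

namespace NStep

/-! ### Verdier quotients by thick subcategories: their kernels and their composition. -/

section Localization

variable {T D D' : Type*} [Category* T] [Category* D] [Category* D']
  [Preadditive T] [HasZeroObject T] [HasShift T ℤ]
  [∀ a : ℤ, (shiftFunctor T a).Additive] [Pretriangulated T] [IsTriangulated T]
  [Preadditive D] [HasZeroObject D] [HasShift D ℤ]
  [∀ a : ℤ, (shiftFunctor D a).Additive] [Pretriangulated D]

/-! Both sides are Verdier quotients of one and the same category, the bounded homotopy category `Kb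
(MF n W)`, by one and the same thick subcategory, the one generated by the abelian-acyclic complexes
together with the bounded complexes of projective-injectives. Only the order in which these objects
are killed differs.

On the left, one divides by the abelian-acyclic complexes, which gives `Dab`, and then by the image
of `KbProjInj`. On the right, one divides by the graded-split acyclic complexes, which gives `Dex`,
then by the image of `KbProjInj`, which gives the stable category through `Tot`, and finally by the
image of the abelian-acyclic complexes. Since a graded-split acyclic complex is abelian-acyclic, the
first of these three steps adds nothing to the total class, and the two generated thick
subcategories agree. The universal property of localization then provides the equivalence and its
compatibility with the two functors from `Kb (MF n W)`.

The principle behind this is the "third isomorphism theorem" for Verdier quotients,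
`isLocalization_comp_triangEnvelope`: dividing by `A` and then by the image of `S` is dividing by `A
⊔ S`. It rests on two facts. By `isLocalization_comp`, a composite of two Verdier quotients is the
Verdier quotient by the preimage of the second thick subcategory. By
`triangEnvelope_map_inverseImage`, that preimage is the thick subcategory generated by `A ⊔ S`. Both
use `isZero_obj_iff`: the kernel of the quotient by a thick subcategory is that subcategory and
nothing larger.

Matrix factorizations as such play almost no role in this argument. The theory of the stable
category enters only through the fact that `Tot` is a triangulated localization functor for the
thick subcategory generated by the projective-injective complexes, and the two exact structures are
compared only through `exAcyclic_le_abAcyclic`. In particular it is never needed separately that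
`q₁` is itself a Verdier quotient functor: everything is compared over `Kb (MF n W)`, and the
isomorphism of functors is brought down to `Dex` at the very end. -/

instance isTriangulated_isZero : ObjectProperty.IsTriangulated (IsZero (C := D)) where
  isStableUnderShiftBy a := ⟨fun _ hX => (shiftFunctor D a).map_isZero hX⟩
  toIsTriangulatedClosed₂ := .mk' fun T hT h₁ h₃ =>
    T.isZero₂_of_isZero₁₃ hT h₁ h₃

/-- With the neighbouring facts about zero objects, this makes the kernel of a triangulated functor
a thick subcategory. To show that such a functor kills everything in a generated thick subcategory,
it is then enough to look at the generators. -/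
instance isStableUnderRetracts_inverseImage (P : ObjectProperty D) [P.IsStableUnderRetracts]
    (F : T ⥤ D) : (P.inverseImage F).IsStableUnderRetracts where
  of_retract r h := prop_of_retract P (r.map F) h

instance isStableUnderRetracts_isZero :
    ObjectProperty.IsStableUnderRetracts (IsZero (C := D)) where
  of_retract r h := by
    rw [IsZero.iff_id_eq_zero, ← r.retract, h.eq_of_tgt r.i 0, zero_comp]

/-- A localization functor with respect to a thick subcategory kills exactly its objects. -/
lemma isZero_obj_iff (P : ObjectProperty T) [P.IsTriangulated] [P.IsStableUnderRetracts]
    (L : T ⥤ D) [L.IsLocalization P.trW] [L.CommShift ℤ] [L.IsTriangulated] (X : T) :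
    IsZero (L.obj X) ↔ P X := by
  constructor
  · intro h
    -- As `L.obj X` is zero, `L` identifies `𝟙 X` with `0`. By the calculus of fractions some `s`
    -- with cone in `P` already equalizes them, and such an `s` is zero.
    obtain ⟨Y, s, ⟨Z, g, δ, hT, hZ⟩, hs⟩ :=
      (MorphismProperty.map_eq_iff_postcomp L P.trW (𝟙 X) 0).1 (h.eq_of_src _ _)
    obtain rfl : s = 0 := by simpa using hs
    -- A triangle on a zero morphism splits: in the rotated triangle the last map is `-0⟦1⟧'`, so
    -- the identity of `X⟦1⟧` lifts through `δ`.
    obtain ⟨i, hi⟩ := Triangle.coyoneda_exact₃ _ (rot_of_distTriang _ hT) (𝟙 (X⟦(1 : ℤ)⟧))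
      (by
        change 𝟙 _ ≫ (-(shiftFunctor T (1 : ℤ)).map (0 : X ⟶ Y)) = 0
        rw [Functor.map_zero, neg_zero, comp_zero])
    -- This is where thickness is indispensable: in general `X⟦1⟧` is only a direct summand of the
    -- cone `Z`, and the kernel of a Verdier quotient is always closed under summands.
    have : P (X⟦(1 : ℤ)⟧) := prop_of_retract P ⟨i, δ, hi.symm⟩ hZ
    exact (P.prop_shift_iff_of_isStableUnderShift X 1).1 this
  · intro h
    -- The cone of `0 ⟶ X` is `X` itself, so `L` inverts this morphism as soon as `X` lies in `P`.
    have : IsIso (L.map (0 : 0 ⟶ X)) := Localization.inverts L P.trW _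
      (trW.mk P (contractible_distinguished₁ X) h)
    exact (isZero_zero D).of_iso ((asIso (L.map (0 : 0 ⟶ X))).symm ≪≫ L.mapZeroObject)

/-- The composition of two Verdier quotients is a Verdier quotient. -/
lemma isLocalization_comp (P : ObjectProperty T) [P.IsTriangulated] [P.IsStableUnderRetracts]
    (Q : ObjectProperty D) [Q.IsTriangulated] [Q.IsStableUnderRetracts]
    (L : T ⥤ D) [L.IsLocalization P.trW] [L.CommShift ℤ] [L.IsTriangulated]
    (L' : D ⥤ D') [L'.IsLocalization Q.trW] :
    (L ⋙ L').IsLocalization (Q.inverseImage L).trW := by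
  -- Three things are needed of the class attached to the preimage of `Q`: the composite inverts it,
  -- it contains `P.trW` because `L` sends `P` to zero objects and these lie in `Q`, and its image
  -- under `L` exhausts `Q.trW` up to isomorphism of arrows.
  refine Functor.IsLocalization.comp L L' P.trW Q.trW _ (Q.inverseImage_trW_isInverted L L')
    (trW_monotone fun X hX => Q.prop_of_isZero ((isZero_obj_iff P L X).2 hX)) ?_
  intro X Y f hf
  -- By the calculus of fractions every arrow of `D` is isomorphic to the image of an arrow of `T`.
  -- Whether the cone of that arrow lies in the preimage of `Q` can be tested after applying `L`.
  have := Localization.essSurj_mapArrow L P.trW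
  let e := L.mapArrow.objObjPreimageIso (Arrow.mk f)
  exact ⟨_, _, _, (Q.inverseImage_trW_iff L _).2 ((Q.trW.arrow_mk_iso_iff e).2 hf), ⟨e⟩⟩

/-! ### Descent of triangulated functors to a Verdier quotient. -/

section

variable [Preadditive D'] [HasZeroObject D'] [HasShift D' ℤ]
  [∀ a : ℤ, (shiftFunctor D' a).Additive] [Pretriangulated D']

/-- A functor out of a Verdier quotient is triangulated if its composition with the quotient
functor is isomorphic to a triangulated functor. -/
lemma exists_commShift_isTriangulated (P : ObjectProperty T) [P.IsTriangulated]
    (L : T ⥤ D) [L.IsLocalization P.trW] [L.CommShift ℤ] [L.IsTriangulated]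
    (F : T ⥤ D') [F.CommShift ℤ] [F.IsTriangulated] (G : D ⥤ D') (e : L ⋙ G ≅ F) :
    ∃ _ : G.CommShift ℤ, G.IsTriangulated := by
  -- Only `F` comes with a compatibility with shifts. The one on `G` is induced from it through `e`,
  -- which is why the statement has to produce it rather than assume it.
  let : Localization.Lifting L P.trW F G := ⟨e⟩
  let := Functor.commShiftOfLocalization L P.trW ℤ F G
  -- A distinguished triangle of `D` is determined up to isomorphism by its first morphism, which
  -- comes from `T` up to isomorphism. So it is isomorphic to the image under `L` of a distinguished
  -- triangle, and `G` acts on such an image as `F` acts on the original.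
  have := Localization.essSurj_mapArrow L P.trW
  have : NatTrans.CommShift (Localization.Lifting.iso L P.trW F G).hom ℤ := inferInstance
  exact ⟨inferInstance, Functor.isTriangulated_of_precomp_iso (Localization.Lifting.iso L P.trW F G)⟩

end

/-! ### Generated thick subcategories and successive quotients. -/

/-- The preimage under a Verdier quotient functor of the thick subcategory generated by a class of
objects. -/
lemma triangEnvelope_map_inverseImage (A S : ObjectProperty T) [A.Nonempty] [S.Nonempty]
    (L : T ⥤ D) [L.IsLocalization A.triangEnvelope.trW] [L.CommShift ℤ] [L.IsTriangulated]
    [IsTriangulated D] :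
    (S.map L).triangEnvelope.inverseImage L = (A ⊔ S).triangEnvelope := by
  have : (A ⊔ S).Nonempty := .mono (le_sup_left : A ≤ A ⊔ S)
  apply le_antisymm
  · let F := (A ⊔ S).triangEnvelope.trW.Q
    let G : D ⥤ (A ⊔ S).triangEnvelope.trW.Localization := Localization.lift F
      (MorphismProperty.IsInvertedBy.of_le _ _ F (Localization.inverts F (A ⊔ S).triangEnvelope.trW)
        (trW_monotone (monotone_triangEnvelope le_sup_left))) L
    let e : L ⋙ G ≅ F := Localization.fac _ _ _
    -- Without this the kernel of `G` would not be known to be closed under shifts and extensions.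
    obtain ⟨_, _⟩ := exists_commShift_isTriangulated A.triangEnvelope L F G e
    have h : (S.map L).triangEnvelope ≤ 
        inverseImage (IsZero (C := (A ⊔ S).triangEnvelope.trW.Localization)) G := by
      -- The kernel of `G` is thick, so only the generators matter; each is isomorphic to some
      -- `L.obj X` with `X` in `S`, on which `G` takes the value `F.obj X` up to isomorphism.
      rw [triangEnvelope_le_iff]
      rintro Y ⟨X, hX, ⟨i⟩⟩
      refine IsZero.of_iso ?_ (G.mapIso i.symm ≪≫ e.app X)
      exact (isZero_obj_iff (A ⊔ S).triangEnvelope F X).2 (le_triangEnvelope _ _ (Or.inr hX))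
    intro X hX
    -- Here the nontrivial direction of `isZero_obj_iff` is used: an object that vanishes in the
    -- quotient by a thick subcategory belongs to it.
    exact (isZero_obj_iff (A ⊔ S).triangEnvelope F X).1 ((h _ hX).of_iso (e.app X).symm)
  -- The preimage of a thick subcategory under `L` is thick, so it is enough that it contains `A`,
  -- whose objects become zero, and `S`, whose objects become generators.
  · rw [triangEnvelope_le_iff, sup_le_iff]
    exact ⟨fun X hX => prop_of_isZero (S.map L).triangEnvelope ((isZero_obj_iff _ L X).2 (le_triangEnvelope _ _ hX)),
      fun X hX => le_triangEnvelope _ _ (prop_map_obj _ _ hX)⟩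

/-- Taking two Verdier quotients successively amounts to taking the Verdier quotient by the thick
subcategory generated by both classes of objects. -/
lemma isLocalization_comp_triangEnvelope (A S : ObjectProperty T) [A.Nonempty] [S.Nonempty]
    (L : T ⥤ D) [L.IsLocalization A.triangEnvelope.trW] [L.CommShift ℤ] [L.IsTriangulated]
    [IsTriangulated D] (L' : D ⥤ D') [L'.IsLocalization (S.map L).triangEnvelope.trW] :
    (L ⋙ L').IsLocalization (A ⊔ S).triangEnvelope.trW := by
  rw [← triangEnvelope_map_inverseImage A S L]
  exact isLocalization_comp A.triangEnvelope _ L L'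

end Localization

end NStep

/-! ### Comparison of the two iterated quotients of the bounded homotopy category. -/

open NStep in
theorem mainTheorem5 {C : Type u} [Category.{v} C] [Abelian C] (n : ℕ) [NeZero n]
    (W : 𝟭 C ⟶ 𝟭 C) :
    ∃ (Φ : NStep.VerdierQuotient (NStep.KbProjInjAb n W) ≌ NStep.Dabs n W)
      (_ : Φ.functor.CommShift ℤ),
      Φ.functor.IsTriangulated ∧
      Nonempty (NStep.q₁ n W ⋙ NStep.quotientFunctor (NStep.KbProjInjAb n W) ⋙ Φ.functor ≅
        NStep.Tot n W ⋙ NStep.q₂ n W) := by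
  -- The common thick subcategory of `Kb (MF n W)` by which both sides turn out to be the quotient.
  let E := (abAcyclic n W ⊔ KbProjInj n W).triangEnvelope
  have : (abAcyclic n W ⊔ KbProjInj n W).Nonempty :=
    .mono (le_sup_left : abAcyclic n W ≤ abAcyclic n W ⊔ KbProjInj n W)
  have : (exAcyclic n W ⊔ KbProjInj n W).Nonempty :=
    .mono (le_sup_left : exAcyclic n W ≤ exAcyclic n W ⊔ KbProjInj n W)
  let L₁ := quotientFunctor (abAcyclic n W) ⋙ quotientFunctor (KbProjInjAb n W)
  let M := quotientFunctor (exAcyclic n W) ⋙ Tot n W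
  let L₂ := M ⋙ q₂ n W
  -- `KbProjInjAb` is by definition the image of `KbProjInj` in `Dab`, so the lemma on successive
  -- quotients applies as it stands.
  have h₁ : L₁.IsLocalization E.trW := isLocalization_comp_triangEnvelope _ _ _ _
  -- The stable category is itself a Verdier quotient of `Kb (MF n W)`; this is the only place where
  -- the identification of `Tot` with a localization functor is used to compute a kernel.
  have hM : M.IsLocalization (exAcyclic n W ⊔ KbProjInj n W).triangEnvelope.trW :=
    isLocalization_comp_triangEnvelope _ _ _ _
  have h₂ : L₂.IsLocalization E.trW := by
    have hq : (q₂ n W).IsLocalization ((abAcyclic n W).map M).triangEnvelope.trW := by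
      -- `totAcyclic` is an image taken in two stages, through `Dex`. Both sides are closed under
      -- isomorphism, so taking the image in one stage along `M` yields the same class.
      have : (abAcyclic n W).map M = totAcyclic n W := by
        ext Y
        constructor
        · rintro ⟨X, hX, ⟨i⟩⟩
          exact ⟨_, prop_map_obj _ _ hX, ⟨i⟩⟩
        · rintro ⟨Z, ⟨X, hX, ⟨j⟩⟩, ⟨i⟩⟩
          exact ⟨X, hX, ⟨(Tot n W).mapIso j ≪≫ i⟩⟩
      rw [this]
      infer_instance
    have := isLocalization_comp_triangEnvelope (exAcyclic n W ⊔ KbProjInj n W) (abAcyclic n W) M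
      (q₂ n W)
    -- The three classes killed on the way are reordered so that `exAcyclic` is absorbed by
    -- `abAcyclic`; what remains is the class generating `E`.
    rwa [sup_right_comm, sup_eq_right.2 (exAcyclic_le_abAcyclic n W)] at this
  let Φ := Localization.uniq L₁ L₂ E.trW
  let e : L₁ ⋙ Φ.functor ≅ L₂ := Localization.compUniqFunctor L₁ L₂ E.trW
  -- Uniqueness of localizations gives only an equivalence of plain categories. It is triangulated
  -- because, composed with the quotient functor `L₁`, it becomes the triangulated functor `L₂`.
  obtain ⟨hΦ, hΦ'⟩ := exists_commShift_isTriangulated E L₁ L₂ Φ.functor e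
  let e₀ : quotientFunctor (exAcyclic n W) ⋙ q₁ n W ≅ quotientFunctor (abAcyclic n W) :=
    Localization.fac _ _ _
  -- The two functors to be compared start from `Dex`, a localization of `Kb (MF n W)`, so an
  -- isomorphism between their restrictions to `Kb (MF n W)` descends. There `e₀` turns `q₁` into
  -- the quotient functor to `Dab`, and the rest is `e`.
  exact ⟨Φ, hΦ, hΦ', ⟨Localization.liftNatIso (quotientFunctor (exAcyclic n W))
    (exAcyclic n W).trW _ _ _ _
    (Functor.isoWhiskerRight e₀ (quotientFunctor (KbProjInjAb n W) ⋙ Φ.functor) ≪≫ e)⟩⟩
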